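/- Let $l\in\mathbb N$, let $A\in\mathbb C^{l\times l}$ be Hermitian with $A\neq 0$, let $b\in\mathbb R^l$ and $c\in\mathbb R$. Put $\widehat A=\frac12(A+A^t)$, let $\mathbb H=\{z\in\mathbb C:\operatorname{Im}z>0\}$, and for $w\in\mathbb H$ let $$\gamma(w)=-\operatorname{Tr}A(I_l+Aw)^{-1}+w\,b^t\big((I_l+2w\widehat A)^{-2}(I_l+w\widehat A)\big)b-c .$$ Then there is a unique function $m:\mathbb H\to\mathbb H$ such that (1) $m$ is complex analytic on all of $\mathbb H$; (2) $\lim_{z\to\infty}z\,m(z)=-1$, the limit being taken as $|z|\to\infty$ with $z\in\mathbb H$; (3) $-\dfrac1{m(z)}=z+\gamma(m(z))$ for all $z\in\mathbb H$. Moreover, $m$ is the Stieltjes transform of a unique probability measure $\rho$ on $\mathbb R$, that is, $m(z)=\int_{\mathbb R}\frac{\rho(\mathrm dx)}{x-z}$ for all $z\in\mathbb H$. -/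

import Mathlib

open scoped Matrix UpperHalfPlane Topology

noncomputable section

/-- The symmetrization `Â = (A + Aᵗ) / 2` of a square matrix. -/
def hatMatrix {l : ℕ} (A : Matrix (Fin l) (Fin l) ℂ) : Matrix (Fin l) (Fin l) ℂ :=
  (1 / 2 : ℂ) • (A + Aᵀ)

/-- The rational function
`γ(m) = - Tr A (I + A m)⁻¹ + m bᵗ ((I + 2 m Â)⁻² (I + m Â)) b - c`.
For Hermitian `A` the matrices `A` and `Â` have real spectrum, so that both matrices which are
inverted here are invertible for all non-real `m`, in particular for all `m` in the upper
half-plane. -/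
def selfEnergy {l : ℕ} (A : Matrix (Fin l) (Fin l) ℂ) (b : Fin l → ℝ) (c : ℝ) (m : ℂ) : ℂ :=
  -(A * (1 + m • A)⁻¹).trace
    + m * ((fun i => (b i : ℂ)) ⬝ᵥ
        (((1 + (2 * m) • hatMatrix A)⁻¹ ^ 2 * (1 + m • hatMatrix A)) *ᵥ fun i => (b i : ℂ)))
    - (c : ℂ)

/-- `m : ℍ → ℍ` is analytic on all of `ℍ`, satisfies `z m(z) → -1` as `z → ∞` in `ℍ`
(that is, as `|z| → ∞`), and solves `-1/m(z) = z + γ(m(z))` for all `z` in `ℍ`. -/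
structure IsScalarSolution {l : ℕ} (A : Matrix (Fin l) (Fin l) ℂ) (b : Fin l → ℝ) (c : ℝ)
    (m : ℍ → ℍ) : Prop where
  /-- `ofComplex` is a left inverse of the inclusion of `ℍ` in `ℂ`, so the function below is `m`
  on the open upper half-plane of `ℂ`. -/
  analytic : AnalyticOnNhd ℂ (fun w : ℂ => (m (UpperHalfPlane.ofComplex w) : ℂ)) {w | 0 < w.im}
  tendsto : Filter.Tendsto (fun z : ℍ => (z : ℂ) * (m z : ℂ))
    (Filter.comap (fun z : ℍ => (z : ℂ)) (Bornology.cobounded ℂ)) (𝓝 (-1))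
  equation : ∀ z : ℍ, -(m z : ℂ)⁻¹ = (z : ℂ) + selfEnergy A b c (m z)

/-- `m` is the Stieltjes transform of the measure `ρ` on `ℝ`: `m(z) = ∫ ρ(dx) / (x - z)` on `ℍ`.
For a finite measure the integrand is bounded and continuous, hence integrable. -/
def IsStieltjesTransform (ρ : MeasureTheory.Measure ℝ) (m : ℍ → ℍ) : Prop :=
  ∀ z : ℍ, (m z : ℂ) = ∫ x : ℝ, 1 / ((x : ℂ) - (z : ℂ)) ∂ρ

end

section

open Filter Set Bornology MeasureTheory

open scoped BoundedContinuousFunction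

/-! Put F(w) = -1/w - γ(w) (`invFun`); the equation says F(m(z)) = z. Diagonalizing A and Â turns γ
into a scalar rational function with poles governed by eigenvalues a_i of A and s_j of Â, and every
s_j lies in the convex hull of the a_i.

The identity |1 + aw|² - a²|w|² = 1 + 2a Re w shows that Im F ≤ 0 wherever some 1 + 2a_i Re w
vanishes while the others are nonnegative. Hence Im F > 0 is impossible on the lateral boundary of
the strip 1 + 2a_i Re w > 0. A solution is near 0 when z is near infinity, so it starts in the strip
and can never leave: it takes values in D = `dom`, the part of the strip where Im F > 0
(`mem_dom_of_invFun_eq`).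

F maps D properly to ℍ (`exists_le_nhds_of_tendsto`): towards 0 it blows up, and along any other
escape from D its limit, when one is not ruled out by Im F > 0, is real. Properness, the open
mapping theorem and connectedness of ℍ give surjectivity. They also show that the values taken
twice, with multiplicity, form either nothing or all of ℍ; the latter fails because near infinity
both preimages would be near 0, where 1/F is a local coordinate. So F is biholomorphic from D to ℍ,
which yields existence and uniqueness of m.

For the measure, the shifts m(z + iη) are holomorphic up to the real line and decay, so Cauchy's
formula represents them by the densities Im m(x + iη)/π. The asymptotics -1/z makes these tight
probability measures, and a weak limit as η → 0 represents m. Uniqueness of ρ is Stieltjes inversion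
with the Poisson kernel. -/

/-! ### Local injectivity and branching of holomorphic functions. -/

theorem AnalyticAt.eventually_injective_of_deriv_ne_zero {f : ℂ → ℂ} {a : ℂ}
    (hf : AnalyticAt ℂ f a) (hd : deriv f a ≠ 0) :
    ∀ᶠ p in 𝓝 (a, a), f p.1 = f p.2 → p.1 = p.2 ∧ deriv f p.1 ≠ 0 := by
  have hs : HasStrictDerivAt f (deriv f a) a := hf.hasStrictDerivAt
  have h1 : ∀ᶠ x in 𝓝 a, deriv f x ≠ 0 := hf.deriv.continuousAt.eventually_ne hd
  have h2 := hs.isLittleO.def (half_pos (norm_pos_iff.2 hd))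
  rw [nhds_prod_eq] at h2 ⊢
  filter_upwards [h2, h1.prod_inl (𝓝 a)] with p hp hp' heq
  refine ⟨?_, hp'⟩
  by_contra hne
  have hpos : 0 < ‖p.1 - p.2‖ := norm_pos_iff.2 (sub_ne_zero.2 hne)
  simp only [heq, sub_self, ContinuousLinearMap.toSpanSingleton_apply, zero_sub, norm_neg,
    smul_eq_mul, norm_mul] at hp
  nlinarith [mul_pos hpos (norm_pos_iff.2 hd)]

/-- Near a critical point f - f(a) = hⁿ with n ≥ 2 and h a local coordinate, so the preimages under
h of two different n-th roots of z - f(a) are two preimages of z. -/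
theorem AnalyticAt.eventually_exists_ne_of_deriv_eq_zero {f : ℂ → ℂ} {a : ℂ}
    (hf : AnalyticAt ℂ f a) (hne : ¬ ∀ᶠ w in 𝓝 a, f w = f a) (hd : deriv f a = 0)
    {U : Set ℂ} (hU : U ∈ 𝓝 a) :
    ∀ᶠ z in 𝓝 (f a), z ≠ f a → ∃ x ∈ U, ∃ y ∈ U, x ≠ y ∧ f x = z ∧ f y = z := by
  have hF : AnalyticAt ℂ (fun w => f w - f a) a := hf.sub analyticAt_const
  obtain ⟨n, g, hg, hg0, hfg⟩ := hF.exists_eventuallyEq_pow_smul_nonzero_iff.2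
    (by simpa only [sub_eq_zero] using hne)
  have hn0 : n ≠ 0 := by
    rintro rfl
    have := hfg.self_of_nhds
    simp at this
    exact hg0 this.symm
  have hn1 : n ≠ 1 := by
    rintro rfl
    have h1 : HasDerivAt (fun w => (w - a) ^ 1 • g w) (g a) a := by
      have := ((hasDerivAt_id a).sub_const a).mul hg.differentiableAt.hasDerivAt
      simpa using! this
    have h2 : HasDerivAt (fun w => f w - f a) (g a) a := h1.congr_of_eventuallyEq hfg
    have h3 := (hf.differentiableAt.hasDerivAt.sub_const (f a)).unique h2
    exact hg0 (h3.symm.trans hd)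
  obtain ⟨C, hC⟩ := IsAlgClosed.exists_pow_nat_eq (g a) (Nat.pos_of_ne_zero hn0)
  have hC0 : C ≠ 0 := by
    rintro rfl
    rw [zero_pow hn0] at hC
    exact hg0 hC.symm
  -- Dividing by `g a` keeps the base of the principal power near 1, away from the branch cut; `C`
  -- restores the missing root.
  set r : ℂ → ℂ := fun w => C * (g w / g a) ^ ((n : ℂ)⁻¹) with hr
  set h : ℂ → ℂ := fun w => (w - a) * r w with hh
  have hran : AnalyticAt ℂ r a := by
    refine analyticAt_const.mul ((hg.div analyticAt_const hg0).cpow analyticAt_const ?_)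
    simp [div_self hg0]
  have hra : r a = C := by simp [hr, div_self hg0]
  have hhan : AnalyticAt ℂ h a := (analyticAt_id.sub analyticAt_const).mul hran
  have hhd : HasDerivAt h C a := by
    have := ((hasDerivAt_id a).sub_const a).mul hran.differentiableAt.hasDerivAt
    simpa [hra] using! this
  have hha : h a = 0 := by simp [hh]
  have hpow : ∀ᶠ w in 𝓝 a, h w ^ n = f w - f a := by
    filter_upwards [hfg] with w hw
    rw [hw, hh]
    simp only [hr, mul_pow, smul_eq_mul]
    rw [hC, ← Complex.cpow_nat_mul, mul_inv_cancel₀ (by exact_mod_cast hn0), Complex.cpow_one,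
      mul_div_cancel₀ _ hg0]
  have hopen : 𝓝 (0 : ℂ) ≤ map h (𝓝 a) := by
    have := hhan.eventually_constant_or_nhds_le_map_nhds
    rw [hha] at this
    refine this.resolve_left fun hc => hC0 ?_
    have h0 : HasDerivAt h 0 a := (hasDerivAt_const a (0 : ℂ)).congr_of_eventuallyEq hc
    exact hhd.unique h0
  have hW : h '' (U ∩ {w | h w ^ n = f w - f a}) ∈ 𝓝 (0 : ℂ) :=
    hopen (image_mem_map (inter_mem hU hpow))
  obtain ⟨ε, hε, hball⟩ := Metric.mem_nhds_iff.1 hW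
  filter_upwards [Metric.ball_mem_nhds (f a) (pow_pos hε n)] with z hz hza
  obtain ⟨ζ, hζ⟩ := IsAlgClosed.exists_pow_nat_eq (z - f a) (Nat.pos_of_ne_zero hn0)
  have hζ0 : ζ ≠ 0 := by
    rintro rfl
    rw [zero_pow hn0] at hζ
    exact hza (sub_eq_zero.1 hζ.symm)
  have hζε : ‖ζ‖ < ε := by
    rw [Metric.mem_ball, dist_eq_norm, ← hζ, norm_pow] at hz
    exact lt_of_pow_lt_pow_left₀ n hε.le hz
  have hω := Complex.isPrimitiveRoot_exp n hn0
  set ω := Complex.exp (2 * Real.pi * Complex.I / n) with hωd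
  have hω1 : ω ≠ 1 := hω.ne_one (by omega)
  have hωn : ω ^ n = 1 := hω.pow_eq_one
  have hωnorm : ‖ω‖ = 1 := hω.norm'_eq_one hn0
  obtain ⟨x, ⟨hxU, hx⟩, hxζ⟩ := hball (show ζ ∈ Metric.ball 0 ε by simpa using hζε)
  obtain ⟨y, ⟨hyU, hy⟩, hyζ⟩ := hball (show ζ * ω ∈ Metric.ball 0 ε by simpa [hωnorm] using hζε)
  refine ⟨x, hxU, y, hyU, ?_, ?_, ?_⟩
  · rintro rfl
    rw [hxζ] at hyζ
    exact hω1 (mul_left_cancel₀ hζ0 (by rw [← hyζ, mul_one]))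
  · have : f x - f a = z - f a := by rw [← hζ, ← hx, hxζ]
    exact sub_left_inj.1 this
  · have : f y - f a = z - f a := by rw [← hζ, ← hy, hyζ, mul_pow, hωn, mul_one]
    exact sub_left_inj.1 this

/-! ### The scalar rational function and the sign of its imaginary part. -/

/-- The data of a rational function `-∑ aᵢ / (1 + aᵢ w) + ∑ βⱼ w (1 + sⱼ w) / (1 + 2 sⱼ w)² - c`
with nonnegative weights `βⱼ`, in which every `sⱼ` lies in the convex hull of the `aᵢ`. -/
structure SpectralData (ι κ : Type*) where
  a : ι → ℝ
  s : κ → ℝ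
  β : κ → ℝ
  c : ℝ
  β_nonneg : ∀ j, 0 ≤ β j
  exists_le : ∀ j, ∃ i, a i ≤ s j
  exists_ge : ∀ j, ∃ i, s j ≤ a i
  exists_ne : ∃ i, a i ≠ 0

theorem Complex.one_add_ofReal_mul_ne_zero {w : ℂ} (hw : 0 < w.im) (a : ℝ) :
    1 + (a : ℂ) * w ≠ 0 := by
  intro h
  have h1 := congrArg Complex.re h
  have h2 := congrArg Complex.im h
  simp only [Complex.add_im, Complex.one_im, Complex.im_ofReal_mul, Complex.zero_im, zero_add,
    mul_eq_zero, hw.ne', or_false] at h2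
  simp [h2] at h1

theorem Complex.one_add_two_mul_ofReal_mul_ne_zero {w : ℂ} (hw : 0 < w.im) (a : ℝ) :
    1 + 2 * (a : ℂ) * w ≠ 0 := by
  have := Complex.one_add_ofReal_mul_ne_zero hw (2 * a)
  push_cast at this
  exact this

theorem Complex.im_ofReal_div_one_add_mul (a : ℝ) (w : ℂ) :
    ((a : ℂ) / (1 + a * w)).im = -(w.im * (a ^ 2 / Complex.normSq (1 + a * w))) := by
  rw [Complex.div_im]
  simp
  ring

theorem Complex.im_mul_one_add_div_sq {w : ℂ} (s : ℝ) (hw : 1 + 2 * (s : ℂ) * w ≠ 0) :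
    (w * (1 + s * w) / (1 + 2 * s * w) ^ 2).im =
      w.im * ((1 + 2 * s * w.re) / Complex.normSq (1 + 2 * s * w) ^ 2) := by
  have hn : Complex.normSq (1 + 2 * s * w) ≠ 0 := fun h => hw (Complex.normSq_eq_zero.1 h)
  rw [Complex.div_im, Complex.normSq_eq_norm_sq, norm_pow, ← pow_mul, mul_comm 2 2, pow_mul,
    ← Complex.normSq_eq_norm_sq, ← sub_div, mul_div_assoc']
  congr 1
  simp [pow_two]
  ring

theorem Complex.im_neg_inv (w : ℂ) : (-w⁻¹).im = w.im * (1 / Complex.normSq w) := by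
  simp [Complex.inv_im]
  ring

namespace SpectralData

variable {ι κ : Type*} (E : SpectralData ι κ)

theorem one_add_sym_nonneg {t : ℝ} (h : ∀ i, 0 ≤ 1 + 2 * E.a i * t) (j : κ) :
    0 ≤ 1 + 2 * E.s j * t := by
  rcases le_total 0 t with ht | ht
  · obtain ⟨i, hi⟩ := E.exists_le j
    nlinarith [h i]
  · obtain ⟨i, hi⟩ := E.exists_ge j
    nlinarith [h i]

/-- An affine function that is nonnegative at the a_i can vanish at a point of their hull only at an
extreme a_i, unless it is constant. -/
theorem sym_eq_of_one_add_eq_zero {t : ℝ} (h : ∀ i, 0 ≤ 1 + 2 * E.a i * t) {j : κ}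
    (hj : 1 + 2 * E.s j * t = 0) : ∃ i, E.a i = E.s j := by
  rcases lt_trichotomy t 0 with ht | rfl | ht
  · obtain ⟨i, hi⟩ := E.exists_ge j
    exact ⟨i, le_antisymm (by nlinarith [h i]) hi⟩
  · simp at hj
  · obtain ⟨i, hi⟩ := E.exists_le j
    exact ⟨i, le_antisymm hi (by nlinarith [h i])⟩

variable [Fintype ι] [Fintype κ]

/-- The rational function described by the spectral data. -/
noncomputable def energy (w : ℂ) : ℂ :=
  -∑ i, (E.a i : ℂ) / (1 + E.a i * w)
    + ∑ j, (E.β j : ℂ) * (w * (1 + E.s j * w) / (1 + 2 * E.s j * w) ^ 2) - E.c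

/-- The functional inverse `w ↦ -1/w - γ(w)` of the solution of `-1/m = z + γ(m)`. -/
noncomputable def invFun (w : ℂ) : ℂ := -w⁻¹ - E.energy w

/-- The part of a vertical strip in the upper half-plane that contains the values of the
solution. -/
def strip : Set ℂ := {w | 0 < w.im ∧ ∀ i, 0 < 1 + 2 * E.a i * w.re}

/-- The image of the upper half-plane under the solution. -/
def dom : Set ℂ := {w | w ∈ E.strip ∧ 0 < (E.invFun w).im}

theorem im_invFun {w : ℂ} (hw : 0 < w.im) :
    (E.invFun w).im = w.im * (1 / Complex.normSq w
      - ∑ i, E.a i ^ 2 / Complex.normSq (1 + E.a i * w)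
      - ∑ j, E.β j * ((1 + 2 * E.s j * w.re) / Complex.normSq (1 + 2 * E.s j * w) ^ 2)) := by
  have h1 : (∑ i, (E.a i : ℂ) / (1 + E.a i * w)).im =
      -(w.im * ∑ i, E.a i ^ 2 / Complex.normSq (1 + E.a i * w)) := by
    rw [Complex.im_sum, Finset.mul_sum, ← Finset.sum_neg_distrib]
    exact Finset.sum_congr rfl fun i _ => Complex.im_ofReal_div_one_add_mul _ _
  have h2 : (∑ j, (E.β j : ℂ) * (w * (1 + E.s j * w) / (1 + 2 * E.s j * w) ^ 2)).im =
      w.im * ∑ j, E.β j * ((1 + 2 * E.s j * w.re) / Complex.normSq (1 + 2 * E.s j * w) ^ 2) := by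
    rw [Complex.im_sum, Finset.mul_sum]
    refine Finset.sum_congr rfl fun j _ => ?_
    rw [Complex.im_ofReal_mul,
      Complex.im_mul_one_add_div_sq _ (Complex.one_add_two_mul_ofReal_mul_ne_zero hw _)]
    ring
  rw [invFun, energy, Complex.sub_im, Complex.im_neg_inv, Complex.sub_im, Complex.add_im,
    Complex.neg_im, h1, h2, Complex.ofReal_im]
  ring

/-- All but one of the a-terms are dropped; the remaining one combines with 1/|w|² through |1 + aw|²
- a²|w|² = 1 + 2a Re w. -/
theorem im_invFun_le {w : ℂ} (hw : 0 < w.im) (i : ι) :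
    (E.invFun w).im ≤ w.im * ((1 + 2 * E.a i * w.re) /
        (Complex.normSq w * Complex.normSq (1 + E.a i * w))
      - ∑ j, E.β j * ((1 + 2 * E.s j * w.re) / Complex.normSq (1 + 2 * E.s j * w) ^ 2)) := by
  rw [E.im_invFun hw]
  refine mul_le_mul_of_nonneg_left (sub_le_sub_right ?_ _) hw.le
  have h0 : Complex.normSq w ≠ 0 := fun h => by
    rw [Complex.normSq_eq_zero.1 h] at hw
    simp at hw
  have h1 : Complex.normSq (1 + E.a i * w) ≠ 0 := fun h =>
    Complex.one_add_ofReal_mul_ne_zero hw _ (Complex.normSq_eq_zero.1 h)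
  have h2 : E.a i ^ 2 / Complex.normSq (1 + E.a i * w) ≤
      ∑ i, E.a i ^ 2 / Complex.normSq (1 + E.a i * w) :=
    Finset.single_le_sum (f := fun i => E.a i ^ 2 / Complex.normSq (1 + E.a i * w))
      (fun i _ => div_nonneg (sq_nonneg _) (Complex.normSq_nonneg _)) (Finset.mem_univ i)
  have h3 : (1 + 2 * E.a i * w.re) / (Complex.normSq w * Complex.normSq (1 + E.a i * w)) =
      1 / Complex.normSq w - E.a i ^ 2 / Complex.normSq (1 + E.a i * w) := by
    rw [div_sub_div _ _ h0 h1]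
    congr 1
    simp [Complex.normSq_apply]
    ring
  rw [h3]
  exact sub_le_sub_left h2 _

theorem im_invFun_le_single {w : ℂ} (hw : 0 < w.im) (h : ∀ i, 0 ≤ 1 + 2 * E.a i * w.re)
    (i : ι) (j : κ) :
    (E.invFun w).im ≤ w.im * ((1 + 2 * E.a i * w.re) /
        (Complex.normSq w * Complex.normSq (1 + E.a i * w))
      - E.β j * ((1 + 2 * E.s j * w.re) / Complex.normSq (1 + 2 * E.s j * w) ^ 2)) := by
  refine (E.im_invFun_le hw i).trans (mul_le_mul_of_nonneg_left (sub_le_sub_left ?_ _) hw.le)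
  exact Finset.single_le_sum (f := fun j => E.β j * ((1 + 2 * E.s j * w.re) /
      Complex.normSq (1 + 2 * E.s j * w) ^ 2))
    (fun j _ => mul_nonneg (E.β_nonneg j)
      (div_nonneg (E.one_add_sym_nonneg h j) (sq_nonneg _))) (Finset.mem_univ j)

/-- The barrier: on the closed strip every β-term has a favourable sign, so where one factor
vanishes nothing positive remains in the bound for Im F. -/
theorem one_add_pos_of_im_invFun_pos {w : ℂ} (hw : 0 < w.im)
    (h : ∀ i, 0 ≤ 1 + 2 * E.a i * w.re) (hF : 0 < (E.invFun w).im) (i : ι) :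
    0 < 1 + 2 * E.a i * w.re := by
  refine lt_of_le_of_ne (h i) fun h0 => hF.not_ge ?_
  refine (E.im_invFun_le hw i).trans ?_
  rw [← h0, zero_div, zero_sub]
  refine mul_nonpos_of_nonneg_of_nonpos hw.le (neg_nonpos.2 (Finset.sum_nonneg fun j _ => ?_))
  exact mul_nonneg (E.β_nonneg j) (div_nonneg (E.one_add_sym_nonneg h j) (sq_nonneg _))

/-- A vanishing weight removes its pole; this alternative matters at real boundary points of the
strip. -/
theorem analyticAt_energy {w : ℂ} (ha : ∀ i, 1 + (E.a i : ℂ) * w ≠ 0)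
    (hs : ∀ j, E.β j = 0 ∨ 1 + 2 * (E.s j : ℂ) * w ≠ 0) : AnalyticAt ℂ E.energy w := by
  have h1 : AnalyticAt ℂ (fun w : ℂ => ∑ i, (E.a i : ℂ) / (1 + E.a i * w)) w := by
    refine Finset.analyticAt_fun_sum _ fun i _ => ?_
    exact analyticAt_const.div (by fun_prop) (ha i)
  have h2 : AnalyticAt ℂ (fun w : ℂ => ∑ j, (E.β j : ℂ) *
      (w * (1 + E.s j * w) / (1 + 2 * E.s j * w) ^ 2)) w := by
    refine Finset.analyticAt_fun_sum _ fun j _ => ?_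
    rcases hs j with h | h
    · simp only [h, Complex.ofReal_zero, zero_mul]
      exact analyticAt_const
    · exact analyticAt_const.mul (AnalyticAt.div (by fun_prop) (by fun_prop) (pow_ne_zero _ h))
  exact (h1.neg.add h2).sub analyticAt_const

theorem analyticAt_energy_zero : AnalyticAt ℂ E.energy 0 :=
  E.analyticAt_energy (by simp) (by simp)

theorem analyticAt_invFun {w : ℂ} (hw : w ≠ 0) (ha : ∀ i, 1 + (E.a i : ℂ) * w ≠ 0)
    (hs : ∀ j, E.β j = 0 ∨ 1 + 2 * (E.s j : ℂ) * w ≠ 0) : AnalyticAt ℂ E.invFun w :=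
  (analyticAt_inv hw).neg.sub (E.analyticAt_energy ha hs)

theorem analyticAt_invFun_of_im_pos {w : ℂ} (hw : 0 < w.im) : AnalyticAt ℂ E.invFun w :=
  E.analyticAt_invFun (by rintro rfl; simp at hw)
    (fun _ => Complex.one_add_ofReal_mul_ne_zero hw _)
    (fun _ => Or.inr (Complex.one_add_two_mul_ofReal_mul_ne_zero hw _))

theorem isOpen_dom : IsOpen E.dom := by
  have h1 : IsOpen E.strip := by
    have : E.strip = {w | 0 < w.im} ∩ ⋂ i, {w | 0 < 1 + 2 * E.a i * w.re} := by
      ext w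
      simp [strip]
    rw [this]
    refine (isOpen_lt continuous_const Complex.continuous_im).inter
      (isOpen_iInter_of_finite fun i => isOpen_lt continuous_const (by fun_prop))
  have h2 : ContinuousOn E.invFun E.strip := fun w hw =>
    (E.analyticAt_invFun_of_im_pos hw.1).continuousAt.continuousWithinAt
  exact h2.isOpen_inter_preimage h1 (isOpen_lt continuous_const Complex.continuous_im)

/-! ### Boundary behaviour of `invFun` on `dom` and properness. -/

theorem exists_invFun_ofReal_eq (x : ℝ) : ∃ y : ℝ, E.invFun x = y :=
  ⟨-x⁻¹ - (-∑ i, E.a i / (1 + E.a i * x)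
    + ∑ j, E.β j * (x * (1 + E.s j * x) / (1 + 2 * E.s j * x) ^ 2) - E.c), by
    simp only [invFun, energy]
    push_cast
    rfl⟩

theorem tendsto_mul_invFun : Tendsto (fun w => w * E.invFun w) (𝓝[≠] 0) (𝓝 (-1)) := by
  have h : Tendsto (fun w : ℂ => -1 - w * E.energy w) (𝓝[≠] 0) (𝓝 (-1)) := by
    have : ContinuousAt (fun w : ℂ => -1 - w * E.energy w) 0 :=
      continuousAt_const.sub (continuousAt_id.mul E.analyticAt_energy_zero.continuousAt)
    simpa using this.tendsto.mono_left nhdsWithin_le_nhds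
  refine h.congr' ?_
  filter_upwards [self_mem_nhdsWithin] with w hw
  rw [invFun, mul_sub, mul_neg, mul_inv_cancel₀ hw]

theorem tendsto_term_cobounded (s : ℝ) (hs : s ≠ 0) :
    Tendsto (fun w : ℂ => w * (1 + s * w) / (1 + 2 * s * w) ^ 2)
      (cobounded ℂ ⊓ 𝓟 {w | 0 < w.im}) (𝓝 ((1 / (4 * s) : ℝ) : ℂ)) := by
  have h1 : Tendsto (fun w : ℂ => 1 + 2 * (s : ℂ) * w) (cobounded ℂ) (cobounded ℂ) :=
    (tendsto_const_add_cobounded 1).comp (tendsto_mul_left_cobounded (by simpa using hs))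
  -- From 4sw(1 + sw) = (1 + 2sw)² - 1.
  have h2 : Tendsto (fun w : ℂ => 1 / (4 * (s : ℂ)) * (1 - ((1 + 2 * (s : ℂ) * w)⁻¹) ^ 2))
      (cobounded ℂ) (𝓝 (1 / (4 * (s : ℂ)) * (1 - 0 ^ 2))) :=
    ((((tendsto_inv₀_cobounded).comp h1).pow 2).const_sub 1).const_mul _
  have h3 : (1 / (4 * (s : ℂ)) * (1 - 0 ^ 2)) = ((1 / (4 * s) : ℝ) : ℂ) := by
    push_cast; ring
  rw [h3] at h2
  refine (h2.mono_left inf_le_left).congr' ?_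
  filter_upwards [mem_inf_of_right (mem_principal_self _)] with w hw
  have h4 := Complex.one_add_two_mul_ofReal_mul_ne_zero hw s
  have h5 : (s : ℂ)⁻¹ * s = 1 := inv_mul_cancel₀ (by exact_mod_cast hs)
  have h6 : ((1 + 2 * (s : ℂ) * w)⁻¹) ^ 2 * (1 + 2 * (s : ℂ) * w) ^ 2 = 1 := by
    rw [← mul_pow, inv_mul_cancel₀ h4, one_pow]
  rw [eq_div_iff (pow_ne_zero 2 h4)]
  linear_combination (-(1 / (4 * (s : ℂ)))) * h6 + (w + s * w ^ 2) * h5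

theorem tendsto_invFun_cobounded (h : ∀ j, E.β j = 0 ∨ E.s j ≠ 0) :
    ∃ x : ℝ, Tendsto E.invFun (cobounded ℂ ⊓ 𝓟 {w | 0 < w.im}) (𝓝 (x : ℂ)) := by
  refine ⟨-(∑ j, E.β j * (1 / (4 * E.s j)) - E.c), ?_⟩
  have h1 : Tendsto (fun w : ℂ => ∑ i, (E.a i : ℂ) / (1 + E.a i * w)) (cobounded ℂ) (𝓝 0) := by
    rw [← Finset.sum_const_zero (s := (Finset.univ : Finset ι))]
    refine tendsto_finsetSum _ fun i _ => ?_
    by_cases hi : E.a i = 0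
    · simp [hi]
    · have h1 : Tendsto (fun w : ℂ => 1 + (E.a i : ℂ) * w) (cobounded ℂ) (cobounded ℂ) :=
        (tendsto_const_add_cobounded 1).comp (tendsto_mul_left_cobounded (by simpa using hi))
      have h2 := ((tendsto_inv₀_cobounded).comp h1).const_mul (E.a i : ℂ)
      simpa [div_eq_mul_inv] using h2
  have h2 : Tendsto (fun w : ℂ => ∑ j, (E.β j : ℂ) *
      (w * (1 + E.s j * w) / (1 + 2 * E.s j * w) ^ 2)) (cobounded ℂ ⊓ 𝓟 {w | 0 < w.im})
      (𝓝 (∑ j, (E.β j : ℂ) * ((1 / (4 * E.s j) : ℝ) : ℂ))) := by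
    refine tendsto_finsetSum _ fun j _ => ?_
    rcases h j with hj | hj
    · simpa [hj] using tendsto_const_nhds
    · exact (tendsto_term_cobounded _ hj).const_mul _
  have h0 : Tendsto (fun w : ℂ => -w⁻¹) (cobounded ℂ ⊓ 𝓟 {w | 0 < w.im}) (𝓝 (-0)) :=
    (tendsto_inv₀_cobounded (α := ℂ)).neg.mono_left inf_le_left
  have h3 := h0.sub (((h1.mono_left inf_le_left).neg.add h2).sub_const (E.c : ℂ))
  have h4 : ((-(∑ j, E.β j * (1 / (4 * E.s j)) - E.c) : ℝ) : ℂ) =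
      -0 - (-0 + ∑ j, (E.β j : ℂ) * ((1 / (4 * E.s j) : ℝ) : ℂ) - E.c) := by
    push_cast
    ring
  rw [h4]
  simpa only [invFun, energy] using! h3

theorem dom_nonneg {w : ℂ} (hw : w ∈ E.dom) (i : ι) : 0 ≤ 1 + 2 * E.a i * w.re := (hw.1.2 i).le

/-- Near a double pole in the boundary of the strip, the imaginary part of `invFun` is not
positive. -/
theorem eventually_notMem_dom {w₀ : ℂ} (h0 : w₀.im = 0) (h : ∀ i, 0 ≤ 1 + 2 * E.a i * w₀.re)
    {j : κ} (hβ : E.β j ≠ 0) (hj : 1 + 2 * (E.s j : ℂ) * w₀ = 0) : ∀ᶠ w in 𝓝 w₀, w ∉ E.dom := by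
  have hre : 1 + 2 * E.s j * w₀.re = 0 := by
    have := congrArg Complex.re hj
    simpa [h0] using this
  -- Since `E.s j` equals some `E.a i`, both terms of the bound carry the same factor 1 + 2s Re w.
  -- Only β|w|²|1 + sw|² ≥ |1 + 2sw|⁴ is left, which holds near the pole.
  obtain ⟨i, hi⟩ := E.sym_eq_of_one_add_eq_zero h hre
  have hw₀ : w₀ ≠ 0 := by
    rintro rfl
    simp at hj
  have hhalf : 1 + (E.s j : ℂ) * w₀ = 1 / 2 := by linear_combination hj / 2
  have hcont : ContinuousAt (fun w : ℂ => E.β j * (Complex.normSq w *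
      Complex.normSq (1 + E.s j * w)) - Complex.normSq (1 + 2 * E.s j * w) ^ 2) w₀ := by
    have := Complex.continuous_normSq
    fun_prop
  have hpos : 0 < E.β j * (Complex.normSq w₀ *
      Complex.normSq (1 + E.s j * w₀)) - Complex.normSq (1 + 2 * E.s j * w₀) ^ 2 := by
    rw [hj, hhalf, map_zero, zero_pow two_ne_zero, sub_zero]
    exact mul_pos (lt_of_le_of_ne (E.β_nonneg j) hβ.symm)
      (mul_pos (Complex.normSq_pos.2 hw₀) (Complex.normSq_pos.2 (by norm_num)))
  filter_upwards [hcont.eventually (lt_mem_nhds hpos)] with w hw hD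
  refine hD.2.not_ge ((E.im_invFun_le_single hD.1.1 (E.dom_nonneg hD) i j).trans ?_)
  refine mul_nonpos_of_nonneg_of_nonpos hD.1.1.le ?_
  rw [hi]
  have hA : 0 < Complex.normSq w * Complex.normSq (1 + E.s j * w) :=
    mul_pos (Complex.normSq_pos.2 fun h => by simpa [h] using hD.1.1)
      (Complex.normSq_pos.2 (Complex.one_add_ofReal_mul_ne_zero hD.1.1 _))
  have hB : 0 < Complex.normSq (1 + 2 * E.s j * w) ^ 2 :=
    pow_pos (Complex.normSq_pos.2 (Complex.one_add_two_mul_ofReal_mul_ne_zero hD.1.1 _)) 2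
  rw [sub_nonpos, mul_div_assoc', div_le_div_iff₀ hA hB]
  nlinarith [hD.1.2 i, hi ▸ hD.1.2 i]

/-- A term with s = 0 is linear in w and contributes -β Im w, which dominates the decaying positive
part near infinity. -/
theorem eventually_notMem_dom_cobounded {j : κ} (hβ : E.β j ≠ 0) (hj : E.s j = 0) :
    ∀ᶠ w in cobounded ℂ, w ∉ E.dom := by
  obtain ⟨i, hi⟩ := E.exists_ne
  have hβ' := lt_of_le_of_ne (E.β_nonneg j) hβ.symm
  have h1 : Tendsto (fun w : ℂ => 1 + (E.a i : ℂ) * w) (cobounded ℂ) (cobounded ℂ) :=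
    (tendsto_const_add_cobounded 1).comp (tendsto_mul_left_cobounded (by simpa using hi))
  have h2 : ∀ᶠ w in cobounded ℂ, 1 ≤ ‖1 + (E.a i : ℂ) * w‖ :=
    h1.eventually (eventually_cobounded_le_norm 1)
  -- The last two thresholds bound 2|a||w| and 1 by β|w|²/2 each, the second using |w| ≥ 1.
  filter_upwards [h2, eventually_cobounded_le_norm (1 : ℝ),
    eventually_cobounded_le_norm (4 * |E.a i| / E.β j),
    eventually_cobounded_le_norm (2 / E.β j)] with w hw1 hw2 hw3 hw4 hD
  refine hD.2.not_ge ((E.im_invFun_le_single hD.1.1 (E.dom_nonneg hD) i j).trans ?_)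
  refine mul_nonpos_of_nonneg_of_nonpos hD.1.1.le ?_
  rw [hj, sub_nonpos]
  simp only [Complex.ofReal_zero, mul_zero, zero_mul, add_zero, map_one, one_pow, div_one, mul_one]
  rw [Complex.normSq_eq_norm_sq, Complex.normSq_eq_norm_sq]
  have hpos : 0 < ‖w‖ ^ 2 * ‖1 + (E.a i : ℂ) * w‖ ^ 2 := by positivity
  rw [div_le_iff₀ hpos]
  rw [div_le_iff₀ hβ'] at hw3 hw4
  have h3 : 2 * E.a i * w.re ≤ 2 * |E.a i| * ‖w‖ := by
    calc 2 * E.a i * w.re ≤ |2 * E.a i * w.re| := le_abs_self _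
      _ = 2 * |E.a i| * |w.re| := by rw [abs_mul, abs_mul, abs_two]
      _ ≤ _ := by gcongr; exact Complex.abs_re_le_norm w
  have h4 : ‖w‖ ^ 2 ≤ ‖w‖ ^ 2 * ‖1 + (E.a i : ℂ) * w‖ ^ 2 :=
    le_mul_of_one_le_right (by positivity) (one_le_pow₀ hw1)
  have h5 : E.β j * ‖w‖ ^ 2 ≤ E.β j * (‖w‖ ^ 2 * ‖1 + (E.a i : ℂ) * w‖ ^ 2) := by gcongr
  nlinarith

/-- On the compact Riemann sphere an ultrafilter has a limit: 0, a point of ℍ in the closed strip, a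
nonzero real point, or infinity. In the last two cases the singular situations are incompatible with
`dom`, and otherwise `invFun` has a real limit. -/
theorem ultrafilter_cases_of_dom_mem {𝒰 : Ultrafilter ℂ} (h𝒰 : E.dom ∈ 𝒰) :
    ↑𝒰 ≤ 𝓝 (0 : ℂ) ∨ (∃ w₀ : ℂ, 0 < w₀.im ∧ (∀ i, 0 ≤ 1 + 2 * E.a i * w₀.re) ∧ ↑𝒰 ≤ 𝓝 w₀) ∨
      ∃ x : ℝ, Tendsto E.invFun 𝒰 (𝓝 (x : ℂ)) := by
  have him : {w : ℂ | 0 < w.im} ∈ 𝒰 := mem_of_superset h𝒰 fun w hw => hw.1.1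
  by_cases hb : ∃ r : ℝ, Metric.closedBall (0 : ℂ) r ∈ 𝒰
  · obtain ⟨r, hr⟩ := hb
    obtain ⟨w₀, -, hw₀⟩ := (isCompact_closedBall (0 : ℂ) r).ultrafilter_le_nhds' 𝒰 hr
    have hge : 0 ≤ w₀.im ∧ ∀ i, 0 ≤ 1 + 2 * E.a i * w₀.re := by
      have hcl : IsClosed {w : ℂ | 0 ≤ w.im ∧ ∀ i, 0 ≤ 1 + 2 * E.a i * w.re} := by
        have : {w : ℂ | 0 ≤ w.im ∧ ∀ i, 0 ≤ 1 + 2 * E.a i * w.re} =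
            {w | 0 ≤ w.im} ∩ ⋂ i, {w | 0 ≤ 1 + 2 * E.a i * w.re} := by
          ext w
          simp
        rw [this]
        exact (isClosed_le continuous_const Complex.continuous_im).inter
          (isClosed_iInter fun i => isClosed_le continuous_const (by fun_prop))
      exact isClosed_iff_ultrafilter.1 hcl w₀ 𝒰 hw₀
        (mem_of_superset h𝒰 fun w hw => ⟨hw.1.1.le, E.dom_nonneg hw⟩)
    rcases hge.1.eq_or_lt with h0 | h0
    · by_cases hz : w₀ = 0
      · exact Or.inl (hz ▸ hw₀)
      refine Or.inr (Or.inr ?_)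
      have hreal : w₀ = (w₀.re : ℂ) := Complex.ext (by simp) (by simp [h0.symm])
      -- In the closed strip 1 + a Re w ≥ 1/2, so the simple poles stay away.
      have ha : ∀ i, 1 + (E.a i : ℂ) * w₀ ≠ 0 := fun i hi => by
        have h1 := congrArg Complex.re hi
        simp only [Complex.add_re, Complex.one_re, Complex.re_ofReal_mul, Complex.zero_re] at h1
        linarith [hge.2 i]
      have hs : ∀ j, E.β j = 0 ∨ 1 + 2 * (E.s j : ℂ) * w₀ ≠ 0 := fun j => by
        by_contra! hj
        have := hw₀ (E.eventually_notMem_dom h0.symm hge.2 hj.1 hj.2)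
        exact 𝒰.compl_notMem_iff.2 h𝒰 this
      obtain ⟨y, hy⟩ := E.exists_invFun_ofReal_eq w₀.re
      refine ⟨y, ?_⟩
      rw [← hy, ← hreal]
      exact (E.analyticAt_invFun hz ha hs).continuousAt.tendsto.mono_left hw₀
    · exact Or.inr (Or.inl ⟨w₀, h0, hge.2, hw₀⟩)
  · push Not at hb
    have hcob : ↑𝒰 ≤ cobounded ℂ := fun t ht => by
      by_contra htU
      rw [Ultrafilter.mem_coe, ← Ultrafilter.compl_mem_iff_notMem] at htU
      obtain ⟨r, hr⟩ := (Metric.isBounded_iff_subset_closedBall (0 : ℂ)).1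
        (isBounded_def.2 (by rwa [compl_compl] : tᶜᶜ ∈ cobounded ℂ))
      exact hb r (mem_of_superset htU hr)
    refine Or.inr (Or.inr ?_)
    by_cases hs : ∀ j, E.β j = 0 ∨ E.s j ≠ 0
    · obtain ⟨x, hx⟩ := E.tendsto_invFun_cobounded hs
      exact ⟨x, hx.mono_left (le_inf hcob (le_principal_iff.2 him))⟩
    · push Not at hs
      obtain ⟨j, hj1, hj2⟩ := hs
      exact absurd (hcob (E.eventually_notMem_dom_cobounded hj1 hj2))
        (𝒰.compl_notMem_iff.2 h𝒰)

theorem dom_subset_compl_zero : E.dom ⊆ {0}ᶜ := by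
  rintro w hw rfl
  simpa using hw.1.1

/-- Properness of `invFun` as a map from `dom` to the upper half-plane. -/
theorem exists_le_nhds_of_tendsto {𝒰 : Ultrafilter ℂ} (h𝒰 : E.dom ∈ 𝒰) {z : ℂ} (hz : 0 < z.im)
    (h : Tendsto E.invFun 𝒰 (𝓝 z)) : ∃ w ∈ E.dom, ↑𝒰 ≤ 𝓝 w ∧ E.invFun w = z := by
  rcases E.ultrafilter_cases_of_dom_mem h𝒰 with h0 | ⟨w, hw, hge, hle⟩ | ⟨x, hx⟩
  · have h1 : Tendsto (fun w => w * E.invFun w) 𝒰 (𝓝 (-1)) :=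
      E.tendsto_mul_invFun.mono_left (le_inf h0
        (le_principal_iff.2 (mem_of_superset h𝒰 E.dom_subset_compl_zero)))
    have h2 : Tendsto (fun w => w * E.invFun w) 𝒰 (𝓝 (0 * z)) := Tendsto.mul h0 h
    have := tendsto_nhds_unique h1 h2
    norm_num at this
  · have h1 := (E.analyticAt_invFun_of_im_pos hw).continuousAt.tendsto.mono_left hle
    have h2 : E.invFun w = z := tendsto_nhds_unique h1 h
    have h3 : 0 < (E.invFun w).im := h2 ▸ hz
    exact ⟨w, ⟨⟨hw, E.one_add_pos_of_im_invFun_pos hw hge h3⟩, h3⟩, hle, h2⟩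
  · rw [tendsto_nhds_unique h hx] at hz
    simp at hz

/-- Of the three limit cases only the limit 0 allows unbounded values. -/
theorem tendsto_zero_of_tendsto_cobounded :
    Tendsto id (comap E.invFun (cobounded ℂ) ⊓ 𝓟 E.dom) (𝓝 (0 : ℂ)) := by
  refine tendsto_iff_ultrafilter _ _ _ |>.2 fun 𝒰 h𝒰 => ?_
  have h1 : Tendsto E.invFun 𝒰 (cobounded ℂ) := tendsto_iff_comap.2 (h𝒰.trans inf_le_left)
  have h2 : E.dom ∈ 𝒰 := le_principal_iff.1 (h𝒰.trans inf_le_right)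
  rcases E.ultrafilter_cases_of_dom_mem h2 with h0 | ⟨w, hw, hge, hle⟩ | ⟨x, hx⟩
  · exact h0
  · have h3 := (E.analyticAt_invFun_of_im_pos hw).continuousAt.tendsto.mono_left hle
    exact absurd h1 (h3.not_tendsto (Metric.disjoint_nhds_cobounded _))
  · exact absurd h1 (hx.not_tendsto (Metric.disjoint_nhds_cobounded _))

end SpectralData

/-! ### Bijectivity of `invFun` from `dom` to the upper half-plane, and its inverse. -/

theorem Complex.tendsto_ofReal_mul_I_nhdsNE_zero :
    Tendsto (fun t : ℝ => (t : ℂ) * Complex.I) (𝓝[>] 0) (𝓝[≠] 0) := by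
  refine tendsto_nhdsWithin_iff.2 ⟨?_, ?_⟩
  · have : Continuous fun t : ℝ => (t : ℂ) * Complex.I := by fun_prop
    simpa using (this.tendsto 0).mono_left nhdsWithin_le_nhds
  · filter_upwards [self_mem_nhdsWithin] with t ht
    have : t ≠ 0 := ne_of_gt ht
    simpa using this

theorem Complex.tendsto_ofReal_mul_I_cobounded :
    Tendsto (fun t : ℝ => (t : ℂ) * Complex.I) atTop (cobounded ℂ ⊓ 𝓟 {z | 0 < z.im}) := by
  refine tendsto_inf.2 ⟨?_, tendsto_principal.2 ?_⟩
  · rw [← tendsto_norm_atTop_iff_cobounded]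
    simpa using tendsto_abs_atTop_atTop
  · filter_upwards [eventually_gt_atTop 0] with t ht
    simpa using ht

namespace SpectralData

variable {ι κ : Type*} [Fintype ι] [Fintype κ] (E : SpectralData ι κ)

theorem dom_nonempty : E.dom.Nonempty := by
  have h1 := E.tendsto_mul_invFun.comp Complex.tendsto_ofReal_mul_I_nhdsNE_zero
  have h2 := (Complex.continuous_re.tendsto _).comp h1
  have h3 : ∀ᶠ t : ℝ in 𝓝[>] 0, ((t : ℂ) * Complex.I * E.invFun (t * Complex.I)).re < 0 :=
    h2.eventually (gt_mem_nhds (by simp))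
  obtain ⟨t, ht, ht0⟩ := (h3.and self_mem_nhdsWithin).exists
  have ht0 : 0 < t := ht0
  refine ⟨t * Complex.I, ⟨by simpa using ht0, by simp⟩, ?_⟩
  simp only [Complex.mul_re, Complex.mul_im, Complex.ofReal_re, Complex.ofReal_im, Complex.I_re,
    Complex.I_im, mul_zero, mul_one, zero_mul, sub_zero, add_zero, zero_sub] at ht
  exact pos_of_mul_pos_right (neg_neg_iff_pos.1 ht) ht0.le

/-- By the identity theorem local constancy would be global on ℍ, contradicting w F(w) → -1 at 0. -/
theorem not_eventually_invFun_eq {w : ℂ} (hw : 0 < w.im) :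
    ¬ ∀ᶠ x in 𝓝 w, E.invFun x = E.invFun w := by
  intro h
  have h1 : AnalyticOnNhd ℂ E.invFun {z | 0 < z.im} := fun z hz => E.analyticAt_invFun_of_im_pos hz
  have h2 := h1.eqOn_of_preconnected_of_eventuallyEq (g := fun _ => E.invFun w)
    analyticOnNhd_const (convex_halfSpace_im_gt 0).isPreconnected hw h
  have h3 := E.tendsto_mul_invFun.comp Complex.tendsto_ofReal_mul_I_nhdsNE_zero
  have h4 : Tendsto (fun t : ℝ => (t : ℂ) * Complex.I * E.invFun w) (𝓝[>] 0)
      (𝓝 (0 * E.invFun w)) :=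
    (Complex.tendsto_ofReal_mul_I_nhdsNE_zero.mono_right nhdsWithin_le_nhds).mul_const _
  have h5 : Tendsto (fun t : ℝ => (t : ℂ) * Complex.I * E.invFun w) (𝓝[>] 0) (𝓝 (-1)) := by
    refine h3.congr' ?_
    filter_upwards [self_mem_nhdsWithin] with t ht
    have ht : 0 < t := ht
    simp only [Function.comp_apply]
    rw [h2 (show 0 < ((t : ℂ) * Complex.I).im by simpa using ht)]
  have := tendsto_nhds_unique h4 h5
  norm_num at this

theorem nhds_le_map_invFun {w : ℂ} (hw : 0 < w.im) : 𝓝 (E.invFun w) ≤ map E.invFun (𝓝 w) :=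
  (E.analyticAt_invFun_of_im_pos hw).eventually_constant_or_nhds_le_map_nhds.resolve_left
    (E.not_eventually_invFun_eq hw)

/-- The image is open by the open mapping theorem and relatively closed by properness, and ℍ is
connected. -/
theorem surjOn_invFun : SurjOn E.invFun E.dom {z | 0 < z.im} := by
  refine (convex_halfSpace_im_gt 0).isPreconnected.subset_of_closure_inter_subset ?_ ?_ ?_
  · refine isOpen_iff_mem_nhds.2 ?_
    rintro _ ⟨w, hw, rfl⟩
    exact E.nhds_le_map_invFun hw.1.1 (image_mem_map (E.isOpen_dom.mem_nhds hw))
  · obtain ⟨w, hw⟩ := E.dom_nonempty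
    exact ⟨_, hw.2, mem_image_of_mem _ hw⟩
  · rintro z ⟨hz, hz0⟩
    have hne : NeBot (𝓝 z ⊓ 𝓟 (E.invFun '' E.dom)) := mem_closure_iff_nhdsWithin_neBot.1 hz
    have hne' := comap_inf_principal_neBot_of_image_mem hne
      (mem_inf_of_right (mem_principal_self (E.invFun '' E.dom)))
    have hle := Ultrafilter.of_le
      (comap E.invFun (𝓝 z ⊓ 𝓟 (E.invFun '' E.dom)) ⊓ 𝓟 E.dom)
    obtain ⟨w, hw, -, h⟩ := E.exists_le_nhds_of_tendsto
      (le_principal_iff.1 (hle.trans inf_le_right)) hz0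
      ((tendsto_iff_comap.2 (hle.trans inf_le_left)).mono_right inf_le_left)
    exact ⟨w, hw, h⟩

/-- The pairs of points at which `invFun` takes a value twice, counted with multiplicity. -/
def doublePairs : Set (ℂ × ℂ) :=
  {p | p.1 ∈ E.dom ∧ p.2 ∈ E.dom ∧ E.invFun p.1 = E.invFun p.2 ∧
    (p.1 = p.2 → deriv E.invFun p.1 = 0)}

/-- A critical point splits into distinct preimages of nearby values; distinct preimages persist in
disjoint neighbourhoods. -/
theorem isOpen_image_doublePairs : IsOpen ((fun p : ℂ × ℂ => E.invFun p.1) '' E.doublePairs) := by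
  refine isOpen_iff_mem_nhds.2 ?_
  rintro _ ⟨⟨x, y⟩, ⟨hx, hy, heq, hd⟩, rfl⟩
  simp only at hx hy heq hd ⊢
  by_cases hxy : x = y
  · filter_upwards [(E.analyticAt_invFun_of_im_pos hx.1.1).eventually_exists_ne_of_deriv_eq_zero
      (E.not_eventually_invFun_eq hx.1.1) (hd hxy) (E.isOpen_dom.mem_nhds hx)] with z hz
    by_cases hzx : z = E.invFun x
    · exact ⟨(x, y), ⟨hx, hy, heq, hd⟩, hzx.symm⟩
    · obtain ⟨x', hx', y', hy', hne, h1, h2⟩ := hz hzx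
      exact ⟨(x', y'), ⟨hx', hy', h1.trans h2.symm, fun h => absurd h hne⟩, h1⟩
  · obtain ⟨V, W, hV, hW, hxV, hyW, hVW⟩ := t2_separation hxy
    have h1 := E.nhds_le_map_invFun hx.1.1
      (image_mem_map (inter_mem (E.isOpen_dom.mem_nhds hx) (hV.mem_nhds hxV)))
    have h2 := E.nhds_le_map_invFun hy.1.1
      (image_mem_map (inter_mem (E.isOpen_dom.mem_nhds hy) (hW.mem_nhds hyW)))
    rw [← heq] at h2
    filter_upwards [h1, h2]
    rintro z ⟨x', ⟨hx', hxV'⟩, hxz⟩ ⟨y', ⟨hy', hyW'⟩, hyz⟩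
    exact ⟨(x', y'), ⟨hx', hy', hxz.trans hyz.symm,
      fun h => absurd h (hVW.ne_of_mem hxV' hyW')⟩, hxz⟩

/-- Properness supplies a limit pair in `dom`. If its two points coalesce, the limit is critical, by
local injectivity at noncritical points. -/
theorem closure_image_doublePairs_subset :
    closure ((fun p : ℂ × ℂ => E.invFun p.1) '' E.doublePairs) ∩ {z | 0 < z.im} ⊆
      (fun p : ℂ × ℂ => E.invFun p.1) '' E.doublePairs := by
  rintro z ⟨hz, hz0⟩
  set U := (fun p : ℂ × ℂ => E.invFun p.1) '' E.doublePairs with hU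
  have hne : NeBot (𝓝 z ⊓ 𝓟 U) := mem_closure_iff_nhdsWithin_neBot.1 hz
  have hne' := comap_inf_principal_neBot_of_image_mem hne (mem_inf_of_right (mem_principal_self U))
  set 𝒱 := Ultrafilter.of (comap (fun p : ℂ × ℂ => E.invFun p.1) (𝓝 z ⊓ 𝓟 U) ⊓ 𝓟 E.doublePairs)
  have hle : ↑𝒱 ≤ comap (fun p : ℂ × ℂ => E.invFun p.1) (𝓝 z ⊓ 𝓟 U) ⊓ 𝓟 E.doublePairs :=
    Ultrafilter.of_le _
  have hT : E.doublePairs ∈ 𝒱 := le_principal_iff.1 (hle.trans inf_le_right)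
  have h1 : Tendsto (fun p : ℂ × ℂ => E.invFun p.1) 𝒱 (𝓝 z) :=
    (tendsto_iff_comap.2 (hle.trans inf_le_left)).mono_right inf_le_left
  have h2 : Tendsto (fun p : ℂ × ℂ => E.invFun p.2) 𝒱 (𝓝 z) := by
    refine h1.congr' ?_
    filter_upwards [hT] with p hp using hp.2.2.1
  obtain ⟨x, hx, hxle, hxz⟩ := E.exists_le_nhds_of_tendsto (𝒰 := 𝒱.map Prod.fst)
    (Ultrafilter.mem_map.2 (mem_of_superset hT fun p hp => hp.1)) hz0 h1
  obtain ⟨y, hy, hyle, hyz⟩ := E.exists_le_nhds_of_tendsto (𝒰 := 𝒱.map Prod.snd)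
    (Ultrafilter.mem_map.2 (mem_of_superset hT fun p hp => hp.2.1)) hz0 h2
  refine ⟨(x, y), ⟨hx, hy, hxz.trans hyz.symm, fun hxy => ?_⟩, hxz⟩
  by_contra hd
  have hinj := (E.analyticAt_invFun_of_im_pos hx.1.1).eventually_injective_of_deriv_ne_zero hd
  have hlim : Tendsto id (𝒱 : Filter (ℂ × ℂ)) (𝓝 (x, x)) :=
    (show Tendsto Prod.fst (𝒱 : Filter (ℂ × ℂ)) (𝓝 x) from hxle).prodMk_nhds
      (show Tendsto Prod.snd (𝒱 : Filter (ℂ × ℂ)) (𝓝 x) from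
        (show x = y from hxy) ▸ hyle)
  obtain ⟨p, hp1, hp2⟩ := ((hlim.eventually hinj).and hT).exists
  obtain ⟨h3, h4⟩ := hp1 hp2.2.2.1
  exact h4 (hp2.2.2.2 h3)

/-- The reciprocal of `invFun` extends analytically to 0 with derivative -1, hence is injective and
noncritical nearby. -/
theorem eventually_notMem_doublePairs : ∀ᶠ p in 𝓝 ((0 : ℂ), (0 : ℂ)), p ∉ E.doublePairs := by
  set k : ℂ → ℂ := fun w => w / (-1 - w * E.energy w) with hk
  have hden : AnalyticAt ℂ (fun w => -1 - w * E.energy w) 0 :=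
    analyticAt_const.sub (analyticAt_id.mul E.analyticAt_energy_zero)
  have hkan : AnalyticAt ℂ k 0 := analyticAt_id.div hden (by simp)
  have hkd : deriv k 0 ≠ 0 := by
    have := ((hasDerivAt_id (0 : ℂ)).div hden.differentiableAt.hasDerivAt (by simp)).deriv
    have h2 : deriv k 0 = -1 := by simpa using! this
    rw [h2]
    norm_num
  have hkF : ∀ w : ℂ, w ≠ 0 → k w = (E.invFun w)⁻¹ := fun w hw => by
    rw [hk, invFun]
    simp only
    rw [show -w⁻¹ - E.energy w = (-1 - w * E.energy w) / w by field_simp, inv_div]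
  filter_upwards [hkan.eventually_injective_of_deriv_ne_zero hkd] with p hp hT
  have h1 : p.1 ≠ 0 := E.dom_subset_compl_zero hT.1
  have h2 : p.2 ≠ 0 := E.dom_subset_compl_zero hT.2.1
  obtain ⟨h3, h4⟩ := hp (by rw [hkF _ h1, hkF _ h2, hT.2.2.1])
  apply h4
  have h5 : k =ᶠ[𝓝 p.1] fun w => (E.invFun w)⁻¹ := by
    filter_upwards [isOpen_ne.mem_nhds h1] with w hw using hkF w hw
  rw [h5.deriv_eq]
  have h6 : E.invFun p.1 ≠ 0 := fun h => by simpa [h] using hT.1.2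
  have h7 := (E.analyticAt_invFun_of_im_pos hT.1.1.1).differentiableAt.hasDerivAt.inv h6
  have h8 := h7.deriv
  rw [hT.2.2.2 h3] at h8
  simpa using! h8

/-- Otherwise every z in ℍ is a double value; letting z → ∞ drives both preimages to 0, where there
are no double pairs. -/
theorem doublePairs_eq_empty : E.doublePairs = ∅ := by
  by_contra hne
  obtain ⟨p, hp⟩ := nonempty_iff_ne_empty.2 hne
  have hsub := (convex_halfSpace_im_gt 0).isPreconnected.subset_of_closure_inter_subset
    E.isOpen_image_doublePairs ⟨_, hp.1.2, mem_image_of_mem _ hp⟩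
    E.closure_image_doublePairs_subset
  have hnb : NeBot (cobounded ℂ ⊓ 𝓟 {z : ℂ | 0 < z.im}) :=
    Complex.tendsto_ofReal_mul_I_cobounded.neBot
  have hnb' := comap_inf_principal_neBot_of_image_mem hnb
    (mem_of_superset (mem_inf_of_right (mem_principal_self _)) hsub)
  set L := comap (fun p : ℂ × ℂ => E.invFun p.1) (cobounded ℂ ⊓ 𝓟 {z : ℂ | 0 < z.im}) ⊓
    𝓟 E.doublePairs
  have hT : E.doublePairs ∈ L := mem_inf_of_right (mem_principal_self _)
  have h1 : Tendsto (fun p : ℂ × ℂ => E.invFun p.1) L (cobounded ℂ) :=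
    (tendsto_iff_comap.2 (inf_le_left : L ≤ _)).mono_right inf_le_left
  have h2 : Tendsto (fun p : ℂ × ℂ => E.invFun p.2) L (cobounded ℂ) := by
    refine h1.congr' ?_
    filter_upwards [hT] with p hp using hp.2.2.1
  have h3 : Tendsto Prod.fst L (𝓝 (0 : ℂ)) := E.tendsto_zero_of_tendsto_cobounded.comp
    (tendsto_inf.2 ⟨tendsto_comap_iff.2 h1,
      tendsto_principal.2 (mem_of_superset hT fun p hp => hp.1)⟩)
  have h4 : Tendsto Prod.snd L (𝓝 (0 : ℂ)) := E.tendsto_zero_of_tendsto_cobounded.comp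
    (tendsto_inf.2 ⟨tendsto_comap_iff.2 h2,
      tendsto_principal.2 (mem_of_superset hT fun p hp => hp.2.1)⟩)
  obtain ⟨q, hq1, hq2⟩ :=
    (((h3.prodMk_nhds h4).eventually E.eventually_notMem_doublePairs).and hT).exists
  exact hq1 hq2

theorem injOn_invFun : InjOn E.invFun E.dom := fun x hx y hy h => by
  by_contra hne
  exact E.doublePairs_eq_empty.subset (show (x, y) ∈ E.doublePairs from
    ⟨hx, hy, h, fun hxy => absurd hxy hne⟩)

theorem deriv_invFun_ne_zero {w : ℂ} (hw : w ∈ E.dom) : deriv E.invFun w ≠ 0 := fun h =>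
  E.doublePairs_eq_empty.subset (show (w, w) ∈ E.doublePairs from ⟨hw, hw, rfl, fun _ => h⟩)

/-- `invFun` has a holomorphic inverse on the upper half-plane, which behaves like `-1/z` at
infinity. -/
theorem exists_inverse : ∃ m : ℂ → ℂ, AnalyticOnNhd ℂ m {z | 0 < z.im} ∧
    (∀ z, 0 < z.im → m z ∈ E.dom ∧ E.invFun (m z) = z) ∧
    Tendsto (fun z => z * m z) (cobounded ℂ ⊓ 𝓟 {z | 0 < z.im}) (𝓝 (-1)) := by
  have hex : ∀ z : ℂ, ∃ w, 0 < z.im → w ∈ E.dom ∧ E.invFun w = z := fun z => by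
    by_cases hz : 0 < z.im
    · obtain ⟨w, hw⟩ := E.surjOn_invFun hz
      exact ⟨w, fun _ => hw⟩
    · exact ⟨0, fun h => absurd h hz⟩
  choose m hm using hex
  have hH : IsOpen {z : ℂ | 0 < z.im} := isOpen_lt continuous_const Complex.continuous_im
  have hev : ∀ z : ℂ, 0 < z.im → ∀ᶠ x in 𝓝 z, E.invFun (m x) = x := fun z hz => by
    filter_upwards [hH.mem_nhds hz] with x hx using (hm x hx).2
  refine ⟨m, ?_, hm, ?_⟩
  · refine DifferentiableOn.analyticOnNhd (fun z hz => ?_) hH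
    -- Properness gives a limit in `dom` along each ultrafilter, and injectivity identifies it with
    -- `m z`.
    have hcont : ContinuousAt m z := by
      refine tendsto_iff_ultrafilter _ _ _ |>.2 fun 𝒰 h𝒰 => ?_
      obtain ⟨w, hw, hle, hwz⟩ := E.exists_le_nhds_of_tendsto (𝒰 := 𝒰.map m) (z := z)
        (Ultrafilter.mem_map.2 (mem_of_superset (h𝒰 (hH.mem_nhds hz)) fun x hx => (hm x hx).1)) hz
        (tendsto_map'_iff.2 ((tendsto_id.mono_left h𝒰).congr' (by
          filter_upwards [h𝒰 (hH.mem_nhds hz)] with x hx using (hm x hx).2.symm)))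
      rwa [E.injOn_invFun (hm z hz).1 hw ((hm z hz).2.trans hwz.symm)]
    exact (HasDerivAt.of_local_left_inverse hcont
      (E.analyticAt_invFun_of_im_pos (hm z hz).1.1.1).differentiableAt.hasDerivAt
      (E.deriv_invFun_ne_zero (hm z hz).1)
      (hev z hz)).differentiableAt.differentiableWithinAt
  · set L := cobounded ℂ ⊓ 𝓟 {z : ℂ | 0 < z.im}
    have hL : {z : ℂ | 0 < z.im} ∈ L := mem_inf_of_right (mem_principal_self _)
    have hdom : ∀ᶠ z in L, m z ∈ E.dom := mem_of_superset hL fun z hz => (hm z hz).1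
    have h1 : Tendsto m L (𝓝 0) := by
      refine E.tendsto_zero_of_tendsto_cobounded.comp
        (tendsto_inf.2 ⟨tendsto_comap_iff.2 ?_, tendsto_principal.2 hdom⟩)
      refine (tendsto_id.mono_left (inf_le_left : L ≤ cobounded ℂ)).congr' ?_
      filter_upwards [hL] with z hz using (hm z hz).2.symm
    have h2 : Tendsto m L (𝓝[≠] 0) := tendsto_nhdsWithin_iff.2
      ⟨h1, hdom.mono fun z hz => E.dom_subset_compl_zero hz⟩
    refine (E.tendsto_mul_invFun.comp h2).congr' ?_
    filter_upwards [hL] with z hz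
    simp only [Function.comp_apply]
    rw [(hm z hz).2, mul_comm]

/-- Every continuous solution that vanishes at infinity takes its values in `dom`. -/
theorem mem_dom_of_invFun_eq {m : ℂ → ℂ} (hc : ContinuousOn m {z | 0 < z.im})
    (hm : ∀ z, 0 < z.im → 0 < (m z).im ∧ E.invFun (m z) = z)
    (h0 : Tendsto m (cobounded ℂ ⊓ 𝓟 {z | 0 < z.im}) (𝓝 0)) {z : ℂ} (hz : 0 < z.im) :
    m z ∈ E.dom := by
  have hH : IsOpen {z : ℂ | 0 < z.im} := isOpen_lt continuous_const Complex.continuous_im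
  have hsub : {z : ℂ | 0 < z.im} ⊆ {z : ℂ | 0 < z.im} ∩ m ⁻¹' E.dom := by
    refine (convex_halfSpace_im_gt 0).isPreconnected.subset_of_closure_inter_subset
      (hc.isOpen_inter_preimage hH E.isOpen_dom) ?_ ?_
    · have hnb : NeBot (cobounded ℂ ⊓ 𝓟 {z : ℂ | 0 < z.im}) :=
        Complex.tendsto_ofReal_mul_I_cobounded.neBot
      have h1 : ∀ᶠ w : ℂ in 𝓝 0, ∀ i, 0 < 1 + 2 * E.a i * w.re := by
        refine eventually_all.2 fun i => ?_
        have : ContinuousAt (fun w : ℂ => 1 + 2 * E.a i * w.re) 0 := by fun_prop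
        exact this.eventually (lt_mem_nhds (by simp))
      obtain ⟨z, h2, hz⟩ := ((h0.eventually h1).and
        (mem_inf_of_right (mem_principal_self {z : ℂ | 0 < z.im}))).exists
      have hz : 0 < z.im := hz
      exact ⟨z, hz, hz, ⟨(hm z hz).1, h2⟩, (hm z hz).2.symm ▸ hz⟩
    · rintro z ⟨hz, hz0⟩
      have hcz : ContinuousAt m z := hc.continuousAt (hH.mem_nhds hz0)
      have hF : 0 < (E.invFun (m z)).im := (hm z hz0).2.symm ▸ hz0
      -- Only weak inequalities survive the limit; the barrier makes them strict again.
      have hge : ∀ i, 0 ≤ 1 + 2 * E.a i * (m z).re := fun i => by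
        have hne : NeBot (𝓝 z ⊓ 𝓟 ({z : ℂ | 0 < z.im} ∩ m ⁻¹' E.dom)) :=
          mem_closure_iff_nhdsWithin_neBot.1 hz
        have h1 : Tendsto (fun x => 1 + 2 * E.a i * (m x).re) (𝓝 z)
            (𝓝 (1 + 2 * E.a i * (m z).re)) :=
          ((Complex.continuous_re.continuousAt.comp hcz).const_mul _).const_add _
        refine ge_of_tendsto (h1.mono_left (inf_le_left : 𝓝 z ⊓ 𝓟 ({z : ℂ | 0 < z.im} ∩ m ⁻¹' E.dom) ≤ 𝓝 z)) ?_
        filter_upwards [mem_inf_of_right (mem_principal_self _)] with x hx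
        exact E.dom_nonneg hx.2 i
      exact ⟨hz0, ⟨(hm z hz0).1, E.one_add_pos_of_im_invFun_pos (hm z hz0).1 hge hF⟩, hF⟩
  exact (hsub hz).2

end SpectralData

/-! ### Diagonalization: from the matrices to spectral data. -/

section

open scoped ComplexOrder

namespace Matrix.IsHermitian

variable {n : Type*} [Fintype n] [DecidableEq n] {A : Matrix n n ℂ} (hA : A.IsHermitian)

/-- The matrix with the eigenvectors of `A` and with eigenvalues `f i`. -/
noncomputable def withEigenvalues (f : n → ℂ) : Matrix n n ℂ :=
  Unitary.conjStarAlgAut ℂ _ hA.eigenvectorUnitary (diagonal f)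

theorem withEigenvalues_eigenvalues : hA.withEigenvalues (fun i => (hA.eigenvalues i : ℂ)) = A :=
  hA.spectral_theorem.symm

theorem withEigenvalues_one : hA.withEigenvalues (fun _ => 1) = 1 := by
  rw [withEigenvalues, diagonal_one, map_one]

theorem withEigenvalues_mul (f g : n → ℂ) :
    hA.withEigenvalues f * hA.withEigenvalues g = hA.withEigenvalues (fun i => f i * g i) := by
  rw [withEigenvalues, withEigenvalues, withEigenvalues, ← map_mul, diagonal_mul_diagonal]

theorem withEigenvalues_add (f g : n → ℂ) :
    hA.withEigenvalues f + hA.withEigenvalues g = hA.withEigenvalues (fun i => f i + g i) := by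
  rw [withEigenvalues, withEigenvalues, withEigenvalues, ← map_add, diagonal_add]

theorem withEigenvalues_sub (f g : n → ℂ) :
    hA.withEigenvalues f - hA.withEigenvalues g = hA.withEigenvalues (fun i => f i - g i) := by
  rw [withEigenvalues, withEigenvalues, withEigenvalues, ← map_sub, diagonal_sub]

theorem withEigenvalues_smul (c : ℂ) (f : n → ℂ) :
    c • hA.withEigenvalues f = hA.withEigenvalues (fun i => c * f i) := by
  rw [withEigenvalues, withEigenvalues, ← map_smul, ← diagonal_smul]
  rfl

theorem one_add_smul_eq (c : ℂ) :
    1 + c • A = hA.withEigenvalues (fun i => 1 + c * hA.eigenvalues i) := by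
  conv_lhs => rw [← hA.withEigenvalues_eigenvalues, ← hA.withEigenvalues_one]
  rw [withEigenvalues_smul, withEigenvalues_add]

theorem inv_withEigenvalues {f : n → ℂ} (hf : ∀ i, f i ≠ 0) :
    (hA.withEigenvalues f)⁻¹ = hA.withEigenvalues (fun i => (f i)⁻¹) := by
  refine Matrix.inv_eq_right_inv ?_
  rw [withEigenvalues_mul, ← hA.withEigenvalues_one]
  exact congrArg _ (funext fun i => mul_inv_cancel₀ (hf i))

theorem trace_withEigenvalues (f : n → ℂ) : (hA.withEigenvalues f).trace = ∑ i, f i := by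
  rw [withEigenvalues, Unitary.conjStarAlgAut_apply, Matrix.trace_mul_comm, ← mul_assoc,
    Unitary.coe_star_mul_self, one_mul, Matrix.trace_diagonal]

/-- Because b is real, bᵗU is the conjugate transpose of U*b; this makes the weights nonnegative. -/
theorem dotProduct_withEigenvalues_mulVec (f : n → ℂ) (b : n → ℝ) :
    (fun i => (b i : ℂ)) ⬝ᵥ (hA.withEigenvalues f *ᵥ fun i => (b i : ℂ)) =
      ∑ j, (Complex.normSq ((star (hA.eigenvectorUnitary : Matrix n n ℂ) *ᵥ
        fun i => (b i : ℂ)) j) : ℂ) * f j := by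
  have hv : (fun i => (b i : ℂ)) ᵥ* (hA.eigenvectorUnitary : Matrix n n ℂ) =
      star (star (hA.eigenvectorUnitary : Matrix n n ℂ) *ᵥ fun i => (b i : ℂ)) := by
    rw [Matrix.star_mulVec, Matrix.star_eq_conjTranspose, Matrix.conjTranspose_conjTranspose]
    congr 1
    ext i
    simp
  rw [withEigenvalues, Unitary.conjStarAlgAut_apply, ← Matrix.mulVec_mulVec,
    ← Matrix.mulVec_mulVec, Matrix.dotProduct_mulVec, hv, dotProduct]
  refine Finset.sum_congr rfl fun j _ => ?_
  rw [Matrix.mulVec_diagonal, Pi.star_apply, Complex.normSq_eq_conj_mul_self, Complex.star_def]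
  ring

theorem posSemidef_withEigenvalues_iff (f : n → ℂ) :
    (hA.withEigenvalues f).PosSemidef ↔ ∀ i, 0 ≤ f i := by
  rw [withEigenvalues, Unitary.conjStarAlgAut_apply,
    Matrix.IsUnit.posSemidef_star_right_conjugate_iff (Unitary.isUnit_coe (U := hA.eigenvectorUnitary)),
    posSemidef_diagonal_iff]

/-- Eigenvalue bounds become semidefinite inequalities, which pass from A to Â since transposition
preserves positivity. -/
theorem posSemidef_sub_smul_one_iff (t : ℝ) :
    (A - (t : ℂ) • (1 : Matrix n n ℂ)).PosSemidef ↔ ∀ i, t ≤ hA.eigenvalues i := by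
  have : A - (t : ℂ) • (1 : Matrix n n ℂ) =
      hA.withEigenvalues (fun i => hA.eigenvalues i - t * 1) := by
    conv_lhs => rw [← hA.withEigenvalues_eigenvalues, ← hA.withEigenvalues_one]
    rw [withEigenvalues_smul, withEigenvalues_sub]
  rw [this, posSemidef_withEigenvalues_iff]
  refine forall_congr' fun i => ?_
  rw [mul_one, sub_nonneg, Complex.real_le_real]

theorem posSemidef_smul_one_sub_iff (t : ℝ) :
    ((t : ℂ) • (1 : Matrix n n ℂ) - A).PosSemidef ↔ ∀ i, hA.eigenvalues i ≤ t := by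
  have : (t : ℂ) • (1 : Matrix n n ℂ) - A =
      hA.withEigenvalues (fun i => t * 1 - hA.eigenvalues i) := by
    conv_lhs => rw [← hA.withEigenvalues_eigenvalues, ← hA.withEigenvalues_one]
    rw [withEigenvalues_smul, withEigenvalues_sub]
  rw [this, posSemidef_withEigenvalues_iff]
  refine forall_congr' fun i => ?_
  rw [mul_one, sub_nonneg, Complex.real_le_real]

theorem trace_mul_inv_one_add_smul {w : ℂ} (hw : 0 < w.im) :
    (A * (1 + w • A)⁻¹).trace =
      ∑ i, (hA.eigenvalues i : ℂ) / (1 + hA.eigenvalues i * w) := by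
  have h : A * (1 + w • A)⁻¹ = hA.withEigenvalues
      (fun i => hA.eigenvalues i * (1 + w * hA.eigenvalues i)⁻¹) := by
    rw [hA.one_add_smul_eq, hA.inv_withEigenvalues fun i => by
      rw [mul_comm]; exact Complex.one_add_ofReal_mul_ne_zero hw _]
    conv_lhs => enter [1]; rw [← hA.withEigenvalues_eigenvalues]
    rw [withEigenvalues_mul]
  rw [h, trace_withEigenvalues]
  exact Finset.sum_congr rfl fun i _ => by rw [mul_comm w, div_eq_mul_inv]

theorem dotProduct_inv_sq_mul_mulVec {w : ℂ} (hw : 0 < w.im) (b : n → ℝ) :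
    (fun i => (b i : ℂ)) ⬝ᵥ (((1 + (2 * w) • A)⁻¹ ^ 2 * (1 + w • A)) *ᵥ fun i => (b i : ℂ)) =
      ∑ j, (Complex.normSq ((star (hA.eigenvectorUnitary : Matrix n n ℂ) *ᵥ
        fun i => (b i : ℂ)) j) : ℂ) *
        ((1 + hA.eigenvalues j * w) / (1 + 2 * hA.eigenvalues j * w) ^ 2) := by
  rw [hA.one_add_smul_eq, hA.one_add_smul_eq, hA.inv_withEigenvalues fun i => by
      rw [mul_right_comm, mul_assoc, mul_comm, mul_right_comm, mul_comm _ (2 : ℂ)]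
      exact Complex.one_add_two_mul_ofReal_mul_ne_zero hw _,
    pow_two, withEigenvalues_mul, withEigenvalues_mul, dotProduct_withEigenvalues_mulVec]
  refine Finset.sum_congr rfl fun j _ => ?_
  rw [show 2 * w * (hA.eigenvalues j : ℂ) = 2 * hA.eigenvalues j * w by ring, ← mul_inv, ← pow_two,
    mul_comm w, inv_mul_eq_div]

end Matrix.IsHermitian

theorem isHermitian_hatMatrix {l : ℕ} {A : Matrix (Fin l) (Fin l) ℂ} (hA : A.IsHermitian) :
    (hatMatrix A).IsHermitian := by
  have h : (A + Aᵀ).IsHermitian := hA.add hA.transpose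
  rw [hatMatrix, Matrix.IsHermitian, Matrix.conjTranspose_smul, h.eq]
  simp

theorem posSemidef_hatMatrix {l : ℕ} {A : Matrix (Fin l) (Fin l) ℂ} (hA : A.PosSemidef) :
    (hatMatrix A).PosSemidef :=
  (hA.add hA.transpose).smul (one_div_nonneg.2 zero_le_two)

theorem hatMatrix_sub_smul_one {l : ℕ} (A : Matrix (Fin l) (Fin l) ℂ) (t : ℂ) :
    hatMatrix (A - t • (1 : Matrix (Fin l) (Fin l) ℂ)) = hatMatrix A - t • 1 := by
  simp only [hatMatrix, Matrix.transpose_sub, Matrix.transpose_smul, Matrix.transpose_one]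
  module

theorem hatMatrix_smul_one_sub {l : ℕ} (A : Matrix (Fin l) (Fin l) ℂ) (t : ℂ) :
    hatMatrix (t • (1 : Matrix (Fin l) (Fin l) ℂ) - A) = t • 1 - hatMatrix A := by
  simp only [hatMatrix, Matrix.transpose_sub, Matrix.transpose_smul, Matrix.transpose_one]
  module

/-- The eigenvalues of `A` and of its symmetrization, with the squared coordinates of `b` in an
eigenbasis of the latter. -/
noncomputable def spectralDataOfMatrix {l : ℕ} {A : Matrix (Fin l) (Fin l) ℂ}
    (hA : A.IsHermitian) (hA0 : A ≠ 0) (b : Fin l → ℝ) (c : ℝ) :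
    SpectralData (Fin l) (Fin l) where
  a := hA.eigenvalues
  s := (isHermitian_hatMatrix hA).eigenvalues
  β j := Complex.normSq ((star ((isHermitian_hatMatrix hA).eigenvectorUnitary :
    Matrix (Fin l) (Fin l) ℂ) *ᵥ fun i => (b i : ℂ)) j)
  c := c
  β_nonneg _ := Complex.normSq_nonneg _
  exists_le j := by
    have : Nonempty (Fin l) := ⟨j⟩
    obtain ⟨i, hi⟩ := Finite.exists_min hA.eigenvalues
    refine ⟨i, ((isHermitian_hatMatrix hA).posSemidef_sub_smul_one_iff _).1 ?_ j⟩
    rw [← hatMatrix_sub_smul_one]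
    exact posSemidef_hatMatrix ((hA.posSemidef_sub_smul_one_iff _).2 hi)
  exists_ge j := by
    have : Nonempty (Fin l) := ⟨j⟩
    obtain ⟨i, hi⟩ := Finite.exists_max hA.eigenvalues
    refine ⟨i, ((isHermitian_hatMatrix hA).posSemidef_smul_one_sub_iff _).1 ?_ j⟩
    rw [← hatMatrix_smul_one_sub]
    exact posSemidef_hatMatrix ((hA.posSemidef_smul_one_sub_iff _).2 hi)
  exists_ne := by
    by_contra! h
    exact hA0 (hA.eigenvalues_eq_zero_iff.1 (funext h))

theorem selfEnergy_eq_energy {l : ℕ} {A : Matrix (Fin l) (Fin l) ℂ}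
    (hA : A.IsHermitian) (hA0 : A ≠ 0) (b : Fin l → ℝ) (c : ℝ) {w : ℂ} (hw : 0 < w.im) :
    selfEnergy A b c w = (spectralDataOfMatrix hA hA0 b c).energy w := by
  rw [selfEnergy, SpectralData.energy, hA.trace_mul_inv_one_add_smul hw,
    (isHermitian_hatMatrix hA).dotProduct_inv_sq_mul_mulVec hw, Finset.mul_sum]
  simp only [spectralDataOfMatrix]
  congr 2
  exact Finset.sum_congr rfl fun j _ => by ring

end

/-! ### Cauchy's formula on the upper half-plane. -/

namespace Complex

theorem integrable_of_norm_le_div_one_add_sq {g : ℝ → ℂ} {C : ℝ} (hc : Continuous g)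
    (hC : ∀ x, ‖g x‖ ≤ C / (1 + x ^ 2)) : Integrable g :=
  (integrable_inv_one_add_sq.const_mul C).mono' hc.aestronglyMeasurable
    (Eventually.of_forall fun x => by simpa [div_eq_mul_inv] using hC x)

/-- Cauchy's theorem on [-R, R] × [0, R]: the top contributes at most 2|C|/R and each vertical side
|C|/R. -/
theorem integral_eq_zero_of_decay {g : ℂ → ℂ} {C R₀ : ℝ}
    (hd : ∀ z : ℂ, 0 ≤ z.im → DifferentiableAt ℂ g z)
    (hR : ∀ z : ℂ, 0 ≤ z.im → R₀ ≤ ‖z‖ → ‖g z‖ ≤ C / (1 + ‖z‖ ^ 2))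
    (hint : Integrable fun x : ℝ => g x) : ∫ x : ℝ, g x = 0 := by
  have h1 : Tendsto (fun R : ℝ => ∫ x in (-R)..R, g x) atTop (𝓝 (∫ x : ℝ, g x)) :=
    intervalIntegral_tendsto_integral hint tendsto_neg_atTop_atBot tendsto_id
  refine tendsto_nhds_unique h1 (squeeze_zero_norm' (a := fun R : ℝ => 4 * |C| / R) ?_ ?_)
  · filter_upwards [eventually_ge_atTop R₀, eventually_gt_atTop 0] with R hR₀ hR0
    have hrect := integral_boundary_rect_eq_zero_of_differentiableOn g (-R : ℂ) (R + R * I)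
      (fun z hz => by
        refine (hd z ?_).differentiableWithinAt
        have := hz.2
        simp only [neg_im, ofReal_im, neg_zero, add_im, mul_im, ofReal_re, I_im, mul_one, I_re,
          mul_zero, add_zero, zero_add, uIcc_of_le hR0.le, mem_preimage] at this
        exact this.1)
    have hbd : ∀ z : ℂ, 0 ≤ z.im → R ≤ ‖z‖ → ‖g z‖ ≤ |C| / R ^ 2 := fun z hz hzR => by
      refine (hR z hz (hR₀.trans hzR)).trans ?_
      gcongr
      · exact le_abs_self C
      · nlinarith
    have htop : ‖∫ x in (-R)..R, g (x + R * I)‖ ≤ |C| / R ^ 2 * |R - -R| := by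
      refine intervalIntegral.norm_integral_le_of_norm_le_const fun x _ => hbd _ (by simp [hR0.le]) ?_
      have := abs_im_le_norm (x + R * I : ℂ)
      simp only [add_im, ofReal_im, mul_im, ofReal_re, I_im, mul_one, I_re, mul_zero, add_zero,
        zero_add] at this
      exact (le_abs_self R).trans this
    have hside : ∀ s : ℝ, |s| = R → ‖∫ y in (0 : ℝ)..R, g (s + y * I)‖ ≤ |C| / R ^ 2 * |R - 0| := by
      intro s hs
      refine intervalIntegral.norm_integral_le_of_norm_le_const fun y hy => hbd _ ?_ ?_
      · rw [uIoc_of_le hR0.le] at hy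
        simpa using hy.1.le
      · have := abs_re_le_norm (s + y * I : ℂ)
        simp only [add_re, ofReal_re, mul_re, I_re, mul_zero, ofReal_im, I_im, mul_one, sub_self,
          add_zero] at this
        exact hs ▸ this
    have hr := hside R (abs_of_pos hR0)
    have hl := hside (-R) (by rw [abs_neg, abs_of_pos hR0])
    simp only [neg_re, ofReal_re, neg_im, ofReal_im, neg_zero, add_re, mul_re, I_re, mul_zero, I_im,
      mul_one, sub_self, add_zero, add_im, mul_im, zero_add, ofReal_zero, zero_mul,
      smul_eq_mul] at hrect
    have heq : ∫ x in (-R)..R, g x = (∫ x in (-R)..R, g (x + R * I)) -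
        I * (∫ y in (0 : ℝ)..R, g (R + y * I)) +
        I * (∫ y in (0 : ℝ)..R, g ((-R : ℝ) + y * I)) := by
      linear_combination hrect
    rw [heq]
    refine (norm_add_le _ _).trans ?_
    refine (add_le_add_left (norm_sub_le _ _) _).trans ?_
    rw [norm_mul, norm_mul, norm_I, one_mul, one_mul]
    have h2 : |C| / R ^ 2 * |R - -R| = 2 * |C| / R := by
      rw [sub_neg_eq_add, abs_of_pos (add_pos hR0 hR0)]
      field_simp
      ring
    have h3 : |C| / R ^ 2 * |R - 0| = |C| / R := by
      rw [sub_zero, abs_of_pos hR0]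
      field_simp
    rw [h2] at htop
    rw [h3] at hr hl
    have h4 : 4 * |C| / R = 2 * |C| / R + |C| / R + |C| / R := by ring
    linarith
  · exact tendsto_const_nhds.div_atTop tendsto_id

theorem one_add_norm_le_mul_norm_sub {a ζ : ℂ} {d : ℝ} (hd : 0 < d) (h : d ≤ ‖ζ - a‖) :
    1 + ‖ζ‖ ≤ ((1 + ‖a‖) / d + 1) * ‖ζ - a‖ := by
  have h1 : ‖ζ‖ ≤ ‖ζ - a‖ + ‖a‖ := norm_le_norm_sub_add ζ a
  have h2 : 1 + ‖a‖ ≤ (1 + ‖a‖) / d * ‖ζ - a‖ := by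
    rw [div_mul_eq_mul_div, le_div_iff₀ hd]
    gcongr
  linarith

theorem norm_div_sub_le {a ζ u : ℂ} {d C : ℝ} (hd : 0 < d) (h : d ≤ ‖ζ - a‖)
    (hu : ‖u‖ ≤ C / (1 + ‖ζ‖)) :
    ‖u / (ζ - a)‖ ≤ C * ((1 + ‖a‖) / d + 1) / (1 + ‖ζ‖ ^ 2) := by
  have h1 := one_add_norm_le_mul_norm_sub hd h
  have hpos : 0 < ‖ζ - a‖ := hd.trans_le h
  have h0 : 0 ≤ ‖ζ‖ := norm_nonneg ζ
  have hC : 0 ≤ C := by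
    have := (norm_nonneg u).trans hu
    by_contra! hC
    exact absurd this (not_le.2 (div_neg_of_neg_of_pos hC (by linarith)))
  set k := (1 + ‖a‖) / d + 1
  have hk : 0 < k := by positivity
  rw [le_div_iff₀ (by positivity)] at hu
  rw [norm_div, div_le_div_iff₀ hpos (by positivity)]
  calc ‖u‖ * (1 + ‖ζ‖ ^ 2) ≤ ‖u‖ * ((1 + ‖ζ‖) * (1 + ‖ζ‖)) := by
        gcongr
        nlinarith
    _ = (‖u‖ * (1 + ‖ζ‖)) * (1 + ‖ζ‖) := by ring
    _ ≤ C * (k * ‖ζ - a‖) := by gcongr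
    _ = _ := by ring

theorem im_le_norm_ofReal_sub {z : ℂ} (hz : 0 < z.im) (x : ℝ) : z.im ≤ ‖(x : ℂ) - z‖ := by
  have := abs_im_le_norm ((x : ℂ) - z)
  rw [sub_im, ofReal_im, zero_sub, abs_neg, abs_of_pos hz] at this
  exact this

theorem ofReal_sub_ne_zero {z : ℂ} (hz : z.im ≠ 0) (x : ℝ) : (x : ℂ) - z ≠ 0 := fun h => hz (by
  have := congrArg im h
  simpa using this)

theorem im_le_norm_sub_conj {z ζ : ℂ} (hz : 0 < z.im) (hζ : 0 ≤ ζ.im) :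
    z.im ≤ ‖ζ - (starRingEnd ℂ) z‖ := by
  have := abs_im_le_norm (ζ - (starRingEnd ℂ) z)
  rw [sub_im, conj_im, sub_neg_eq_add, abs_of_pos (by linarith)] at this
  linarith

theorem integral_inv_mul_inv_conj {z : ℂ} (hz : 0 < z.im) :
    Integrable (fun x : ℝ => (((x : ℂ) - (starRingEnd ℂ) z) * ((x : ℂ) - z))⁻¹) ∧
    ∫ x : ℝ, (((x : ℂ) - (starRingEnd ℂ) z) * ((x : ℂ) - z))⁻¹ = (Real.pi / z.im : ℝ) := by
  have h1 : ∀ x : ℝ, (((x : ℂ) - (starRingEnd ℂ) z) * ((x : ℂ) - z))⁻¹ =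
      ((Real.pi / z.im * ProbabilityTheory.cauchyPDFReal z.re z.im.toNNReal x : ℝ) : ℂ) := by
    intro x
    have h2 : ((x : ℂ) - (starRingEnd ℂ) z) * ((x : ℂ) - z) =
        (((x - z.re) ^ 2 + z.im ^ 2 : ℝ) : ℂ) := by
      apply Complex.ext
      · simp [pow_two]
      · simp [pow_two]
        ring
    rw [h2, ← ofReal_inv, ProbabilityTheory.cauchyPDFReal_def]
    congr 1
    rw [Real.coe_toNNReal _ hz.le]
    field_simp [Real.pi_ne_zero, hz.ne']
  simp_rw [h1]
  refine ⟨((ProbabilityTheory.integrable_cauchyPDFReal _).const_mul _).ofReal, ?_⟩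
  rw [integral_complex_ofReal, integral_const_mul, ProbabilityTheory.integral_cauchyPDFReal_eq_one, mul_one]
  exact (Real.toNNReal_pos.2 hz).ne'

variable {f : ℂ → ℂ} {C : ℝ}

theorem integrable_div_ofReal_sub (hd : ∀ z : ℂ, 0 ≤ z.im → DifferentiableAt ℂ f z)
    (hC : ∀ z : ℂ, 0 ≤ z.im → ‖f z‖ ≤ C / (1 + ‖z‖)) {z : ℂ} (hz : z.im ≠ 0) :
    Integrable fun x : ℝ => f x / ((x : ℂ) - z) := by
  refine integrable_of_norm_le_div_one_add_sq (C := C * ((1 + ‖z‖) / |z.im| + 1)) ?_ fun x => ?_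
  · refine Continuous.div ?_ (by fun_prop) (ofReal_sub_ne_zero hz)
    exact continuous_iff_continuousAt.2 fun x =>
      ((hd x (by simp)).continuousAt).comp continuous_ofReal.continuousAt
  · have := norm_div_sub_le (ζ := x) (a := z) (abs_pos.2 hz) (by
      simpa using abs_im_le_norm ((x : ℂ) - z)) (hC x (by simp))
    simpa using this

theorem integral_div_sub_conj_eq_zero (hd : ∀ z : ℂ, 0 ≤ z.im → DifferentiableAt ℂ f z)
    (hC : ∀ z : ℂ, 0 ≤ z.im → ‖f z‖ ≤ C / (1 + ‖z‖)) {z : ℂ} (hz : 0 < z.im) :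
    ∫ x : ℝ, f x / ((x : ℂ) - (starRingEnd ℂ) z) = 0 := by
  refine integral_eq_zero_of_decay (g := fun ζ => f ζ / (ζ - (starRingEnd ℂ) z)) (R₀ := 0)
    (fun ζ hζ => ?_)
    (fun ζ hζ _ => norm_div_sub_le hz (im_le_norm_sub_conj hz hζ) (hC ζ hζ))
    (integrable_div_ofReal_sub hd hC (by simpa using hz.ne'))
  refine (hd ζ hζ).div (by fun_prop) fun h => ?_
  have := im_le_norm_sub_conj hz hζ
  rw [h, norm_zero] at this
  linarith

/-- The Cauchy integral formula for the upper half-plane. -/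
theorem integral_div_sub_eq (hd : ∀ z : ℂ, 0 ≤ z.im → DifferentiableAt ℂ f z)
    (hC : ∀ z : ℂ, 0 ≤ z.im → ‖f z‖ ≤ C / (1 + ‖z‖)) {z : ℂ} (hz : 0 < z.im) :
    ∫ x : ℝ, f x / ((x : ℂ) - z) = 2 * Real.pi * I * f z := by
  set zc := (starRingEnd ℂ) z with hzc
  -- Subtracting K/(ζ - z̄) rather than the constant f(z) cancels the pole at z while keeping decay
  -- at infinity; its integral is the Cauchy density.
  set K : ℂ := f z * (z - zc) with hK
  set h : ℂ → ℂ := fun ζ => f ζ - K / (ζ - zc) with hh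
  have hne : ∀ ζ : ℂ, 0 ≤ ζ.im → ζ - zc ≠ 0 := fun ζ hζ h0 => by
    have := im_le_norm_sub_conj hz hζ
    rw [← hzc, h0, norm_zero] at this
    linarith
  have hhz : h z = 0 := by
    rw [hh, hK]
    simp only
    rw [mul_div_assoc, div_self (hne z hz.le), mul_one, sub_self]
  have hhd : ∀ ζ : ℂ, 0 ≤ ζ.im → DifferentiableAt ℂ h ζ := fun ζ hζ =>
    (hd ζ hζ).sub ((differentiableAt_const _).div (by fun_prop) (hne ζ hζ))
  have hQ : ∀ ζ : ℂ, ζ ≠ z → dslope h z ζ = h ζ / (ζ - z) := fun ζ hζ => by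
    rw [dslope_of_ne _ hζ, slope_def_field, hhz, sub_zero]
  have hreal : ∀ x : ℝ, dslope h z x =
      f x / ((x : ℂ) - z) - K * (((x : ℂ) - zc) * ((x : ℂ) - z))⁻¹ := fun x => by
    have h1 := ofReal_sub_ne_zero hz.ne' x
    rw [hQ _ (sub_ne_zero.1 h1), hh]
    simp only
    rw [sub_div, div_div, div_eq_mul_inv K]
  have hint1 := integrable_div_ofReal_sub hd hC hz.ne'
  obtain ⟨hint2, hval⟩ := integral_inv_mul_inv_conj hz
  have hzero : ∫ x : ℝ, dslope h z x = 0 := by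
    have hH : IsOpen {z : ℂ | 0 < z.im} := isOpen_lt continuous_const continuous_im
    have hhC : ∀ ζ : ℂ, 0 ≤ ζ.im → ‖h ζ‖ ≤
        (C + ‖K‖ * ((1 + ‖zc‖) / z.im + 1)) / (1 + ‖ζ‖) := fun ζ hζ => by
      refine (norm_sub_le _ _).trans ?_
      rw [add_div]
      refine add_le_add (hC ζ hζ) ?_
      have h2 := one_add_norm_le_mul_norm_sub hz (im_le_norm_sub_conj hz hζ)
      rw [norm_div, div_le_div_iff₀ (norm_pos_iff.2 (hne ζ hζ)) (by positivity), mul_assoc]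
      gcongr
    refine integral_eq_zero_of_decay
      (C := (C + ‖K‖ * ((1 + ‖zc‖) / z.im + 1)) * ((1 + ‖z‖) / z.im + 1))
      (R₀ := ‖z‖ + z.im) (fun ζ hζ => ?_) (fun ζ hζ hζR => ?_) ?_
    · by_cases hζz : ζ = z
      · have h1 : DifferentiableOn ℂ h {z : ℂ | 0 < z.im} := fun w hw =>
          (hhd w (le_of_lt hw)).differentiableWithinAt
        rw [hζz]
        exact ((differentiableOn_dslope (hH.mem_nhds hz)).2 h1).differentiableAt (hH.mem_nhds hz)
      · exact (differentiableAt_dslope_of_ne hζz).2 (hhd ζ hζ)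
    · have h3 : z.im ≤ ‖ζ - z‖ := by
        have := norm_sub_norm_le ζ z
        linarith
      rw [hQ ζ (fun h => by rw [h, sub_self, norm_zero] at h3; linarith)]
      exact norm_div_sub_le hz h3 (hhC ζ hζ)
    · simp_rw [hreal]
      exact hint1.sub (hint2.const_mul K)
  simp_rw [hreal] at hzero
  rw [integral_sub hint1 (hint2.const_mul K), integral_const_mul, hval, sub_eq_zero] at hzero
  have h4 : z - zc = 2 * z.im * I := by
    rw [hzc, sub_conj]
    push_cast
    ring
  have h5 : (z.im : ℂ) ≠ 0 := by exact_mod_cast hz.ne'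
  rw [hzero, hK, h4]
  push_cast
  field_simp

/-- A function on the closed upper half-plane that decays at infinity is the Poisson-type integral
of the imaginary part of its boundary values. -/
theorem integral_im_div_sub_eq (hd : ∀ z : ℂ, 0 ≤ z.im → DifferentiableAt ℂ f z)
    (hC : ∀ z : ℂ, 0 ≤ z.im → ‖f z‖ ≤ C / (1 + ‖z‖)) {z : ℂ} (hz : 0 < z.im) :
    Integrable (fun x : ℝ => ((f x).im : ℂ) / ((x : ℂ) - z)) ∧
    ∫ x : ℝ, ((f x).im : ℂ) / ((x : ℂ) - z) = Real.pi * f z := by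
  have h1 := integral_div_sub_eq hd hC hz
  have hi1 := integrable_div_ofReal_sub hd hC hz.ne'
  have hi2 := integrable_div_ofReal_sub hd hC (z := (starRingEnd ℂ) z) (by simpa using hz.ne')
  -- The conjugate part integrates to 0, since it is the conjugate of an integral whose pole z̄ lies
  -- in the lower half-plane.
  have h3 : ∀ x : ℝ, (starRingEnd ℂ) (f x) / ((x : ℂ) - z) =
      (starRingEnd ℂ) (f x / ((x : ℂ) - (starRingEnd ℂ) z)) := fun x => by
    rw [map_div₀, map_sub, conj_conj, conj_ofReal]
  have hi3 : Integrable fun x : ℝ => (starRingEnd ℂ) (f x) / ((x : ℂ) - z) := by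
    simp_rw [h3]
    exact (LinearIsometryEquiv.integrable_comp_iff conjLIE).2 hi2
  have h2 : ∫ x : ℝ, (starRingEnd ℂ) (f x) / ((x : ℂ) - z) = 0 := by
    simp_rw [h3]
    rw [integral_conj, integral_div_sub_conj_eq_zero hd hC hz, map_zero]
  have h4 : ∀ x : ℝ, ((f x).im : ℂ) / ((x : ℂ) - z) =
      (2 * I)⁻¹ * (f x / ((x : ℂ) - z) - (starRingEnd ℂ) (f x) / ((x : ℂ) - z)) := fun x => by
    rw [← sub_div, sub_conj]
    push_cast
    field_simp
  simp_rw [h4]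
  refine ⟨(hi1.sub hi3).const_mul _, ?_⟩
  rw [integral_const_mul, integral_sub hi1 hi3, h1, h2, sub_zero]
  field_simp

end Complex

/-! ### Stieltjes inversion and measures given by boundary values. -/

namespace Complex

theorem integral_cauchyPDFReal_eq_im (ρ : Measure ℝ) [IsFiniteMeasure ρ] {η : NNReal} (hη : η ≠ 0)
    (t : ℝ) : ∫ x, ProbabilityTheory.cauchyPDFReal x η t ∂ρ =
      Real.pi⁻¹ * (∫ x : ℝ, 1 / ((x : ℂ) - (t + η * I)) ∂ρ).im := by
  have hη0 : 0 < (η : ℝ) := by positivity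
  have him : (t + η * I : ℂ).im ≠ 0 := by simpa using hη0.ne'
  have hint : Integrable (fun x : ℝ => 1 / ((x : ℂ) - (t + η * I))) ρ := by
    refine Integrable.of_bound (C := 1 / (η : ℝ)) ?_ (Eventually.of_forall fun x => ?_)
    · exact (Continuous.div (by fun_prop) (by fun_prop)
        (ofReal_sub_ne_zero him)).aestronglyMeasurable
    · have := im_le_norm_ofReal_sub (z := t + η * I) (by simpa using hη0) x
      rw [norm_div, norm_one]
      gcongr
      simpa using this
  have h1 : ∀ x : ℝ, ProbabilityTheory.cauchyPDFReal x η t =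
      Real.pi⁻¹ * (1 / ((x : ℂ) - (t + η * I))).im := fun x => by
    rw [ProbabilityTheory.cauchyPDFReal_def, div_im, normSq_apply]
    simp only [sub_re, add_re, ofReal_re, mul_re, I_re, mul_zero, ofReal_im, I_im, mul_one,
      sub_im, add_im, mul_im, one_im, one_re]
    have : ((x - (t + (0 - 0))) * (x - (t + (0 - 0))) + (0 - (0 + ((η : ℝ) + 0))) *
        (0 - (0 + ((η : ℝ) + 0)))) = (t - x) ^ 2 + (η : ℝ) ^ 2 := by ring
    rw [this]
    ring
  simp_rw [h1]
  rw [integral_const_mul]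
  congr 1
  exact integral_im hint

/-- The Poisson kernel is an approximate identity: Fubini and t = x + ηs reduce the limit to
dominated convergence against the standard Cauchy density. -/
theorem tendsto_integral_mul_integral_cauchyPDFReal (ρ : Measure ℝ) [IsProbabilityMeasure ρ]
    (f : ℝ →ᵇ ℝ) {η : ℕ → NNReal} (hη : ∀ n, η n ≠ 0) (hlim : Tendsto η atTop (𝓝 0)) :
    Tendsto (fun n => ∫ t, f t * ∫ x, ProbabilityTheory.cauchyPDFReal x (η n) t ∂ρ) atTop
      (𝓝 (∫ x, f x ∂ρ)) := by
  set p : ℝ → ℝ := ProbabilityTheory.cauchyPDFReal 0 1 with hp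
  have hpint : Integrable p := ProbabilityTheory.integrable_cauchyPDFReal 0
  have hp1 : ∫ s, p s = 1 := ProbabilityTheory.integral_cauchyPDFReal_eq_one 0 one_ne_zero
  have hp0 : ∀ s, 0 ≤ p s := fun s => (ProbabilityTheory.cauchyPDF_pos 0 one_ne_zero s).le
  have hpc : Continuous p := by
    rw [hp, funext (ProbabilityTheory.cauchyPDFReal_def 0 1)]
    refine continuous_const.mul (Continuous.inv₀ (by fun_prop) fun s => ?_)
    simp only [NNReal.coe_one]
    positivity
  have hdom : Integrable (fun q : ℝ × ℝ => ‖f‖ * (1 * p q.2)) (ρ.prod volume) :=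
    ((integrable_const (1 : ℝ)).mul_prod hpint).const_mul _
  have h1 : Tendsto (fun n => ∫ q : ℝ × ℝ, f (q.1 + η n * q.2) * p q.2 ∂(ρ.prod volume)) atTop
      (𝓝 (∫ q : ℝ × ℝ, f q.1 * p q.2 ∂(ρ.prod volume))) := by
    refine tendsto_integral_of_dominated_convergence _ (fun n => ?_) hdom (fun n => ?_) ?_
    · exact (Continuous.mul (f.continuous.comp (by fun_prop))
        (hpc.comp continuous_snd)).aestronglyMeasurable
    · refine Eventually.of_forall fun q => ?_
      rw [norm_mul, one_mul, Real.norm_of_nonneg (hp0 _)]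
      exact mul_le_mul_of_nonneg_right (f.norm_coe_le_norm _) (hp0 _)
    · refine Eventually.of_forall fun q => ?_
      have h2 : Tendsto (fun n => q.1 + (η n : ℝ) * q.2) atTop (𝓝 (q.1 + (0 : NNReal) * q.2)) :=
        ((NNReal.tendsto_coe.2 hlim).mul_const _).const_add _
      rw [NNReal.coe_zero, zero_mul, add_zero] at h2
      exact ((f.continuous.tendsto _).comp h2).mul_const _
  rw [integral_prod_mul, hp1, mul_one] at h1
  refine h1.congr fun n => ?_
  have hη0 : 0 < (η n : ℝ) := NNReal.coe_pos.2 (pos_iff_ne_zero.2 (hη n))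
  have hn : Integrable (fun q : ℝ × ℝ => f (q.1 + η n * q.2) * p q.2) (ρ.prod volume) := by
    refine hdom.mono' ?_ (Eventually.of_forall fun q => ?_)
    · exact (Continuous.mul (f.continuous.comp (by fun_prop))
        (hpc.comp continuous_snd)).aestronglyMeasurable
    · rw [norm_mul, one_mul, Real.norm_of_nonneg (hp0 _)]
      exact mul_le_mul_of_nonneg_right (f.norm_coe_le_norm _) (hp0 _)
  have hPc : Continuous fun q : ℝ × ℝ => ProbabilityTheory.cauchyPDFReal q.1 (η n) q.2 := by
    simp only [ProbabilityTheory.cauchyPDFReal]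
    exact continuous_const.mul (Continuous.inv₀ (by fun_prop) fun q => by positivity)
  have hP : Integrable (fun q : ℝ × ℝ => ProbabilityTheory.cauchyPDFReal q.1 (η n) q.2)
      (ρ.prod volume) := by
    rw [integrable_prod_iff hPc.aestronglyMeasurable]
    refine ⟨Eventually.of_forall fun x => ProbabilityTheory.integrable_cauchyPDFReal x, ?_⟩
    have : ∀ x : ℝ, ∫ t, ‖ProbabilityTheory.cauchyPDFReal x (η n) t‖ = 1 := fun x => by
      simp_rw [fun t => Real.norm_of_nonneg (ProbabilityTheory.cauchyPDF_pos x (hη n) t).le]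
      exact ProbabilityTheory.integral_cauchyPDFReal_eq_one x (hη n)
    simp_rw [this]
    exact integrable_const 1
  have hfP : Integrable (fun q : ℝ × ℝ => f q.2 * ProbabilityTheory.cauchyPDFReal q.1 (η n) q.2)
      (ρ.prod volume) :=
    hP.bdd_mul (c := ‖f‖) (f.continuous.comp continuous_snd).aestronglyMeasurable
      (Eventually.of_forall fun q => f.norm_coe_le_norm _)
  rw [integral_prod _ hn]
  have hsub : ∀ x : ℝ, ∫ s, f (x + η n * s) * p s =
      ∫ t, f t * ProbabilityTheory.cauchyPDFReal x (η n) t := fun x => by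
    set g : ℝ → ℝ := fun t => f t * ProbabilityTheory.cauchyPDFReal x (η n) t with hg
    have h3 : ∀ s : ℝ, f (x + η n * s) * p s = η n * g (x + η n * s) := fun s => by
      rw [hg, hp]
      simp only
      rw [ProbabilityTheory.cauchyPDFReal_def', ProbabilityTheory.cauchyPDFReal_def',
        add_sub_cancel_left, mul_div_cancel_left₀ _ hη0.ne']
      push_cast
      simp only [sub_zero, div_one, inv_one, mul_one]
      field_simp
    simp_rw [h3]
    rw [integral_const_mul, Measure.integral_comp_mul_left (fun u => g (x + u)) (η n : ℝ),
      integral_add_left_eq_self g x, smul_eq_mul, abs_of_pos (inv_pos.2 hη0), ← mul_assoc,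
      mul_inv_cancel₀ hη0.ne', one_mul]
  simp_rw [hsub]
  rw [integral_integral_swap hfP]
  refine integral_congr_ae (Eventually.of_forall fun t => ?_)
  simp only
  rw [integral_const_mul]

/-- A probability measure is determined by its Stieltjes transform. -/
theorem measure_eq_of_stieltjes_eq (ρ ρ' : Measure ℝ) [IsProbabilityMeasure ρ]
    [IsProbabilityMeasure ρ'] (h : ∀ z : ℂ, 0 < z.im →
      ∫ x : ℝ, 1 / ((x : ℂ) - z) ∂ρ = ∫ x : ℝ, 1 / ((x : ℂ) - z) ∂ρ') : ρ = ρ' := by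
  refine ext_of_forall_integral_eq_of_IsFiniteMeasure fun f => ?_
  obtain ⟨η, -, hη, hlim⟩ := exists_seq_strictAnti_tendsto (0 : NNReal)
  have h1 := tendsto_integral_mul_integral_cauchyPDFReal ρ f (fun n => (hη n).ne') hlim
  have h2 := tendsto_integral_mul_integral_cauchyPDFReal ρ' f (fun n => (hη n).ne') hlim
  refine tendsto_nhds_unique h1 (h2.congr fun n => ?_)
  simp_rw [integral_cauchyPDFReal_eq_im _ (hη n).ne']
  refine integral_congr_ae (Eventually.of_forall fun t => ?_)
  simp only
  rw [h _ (by simpa using hη n)]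

/-- The measure on the real line with density `π⁻¹ Im f`. -/
noncomputable def boundaryMeasure (f : ℂ → ℂ) : Measure ℝ :=
  volume.withDensity fun x => ENNReal.ofReal ((f x).im / Real.pi)

variable {f : ℂ → ℂ} {C : ℝ}

theorem continuous_im_ofReal_of_differentiableAt
    (hd : ∀ z : ℂ, 0 ≤ z.im → DifferentiableAt ℂ f z) : Continuous fun x : ℝ => (f x).im :=
  continuous_im.comp (continuous_iff_continuousAt.2 fun x =>
    ((hd x (by simp)).continuousAt).comp continuous_ofReal.continuousAt)

theorem measurable_density (hd : ∀ z : ℂ, 0 ≤ z.im → DifferentiableAt ℂ f z) :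
    Measurable fun x : ℝ => ENNReal.ofReal ((f x).im / Real.pi) :=
  ((continuous_im_ofReal_of_differentiableAt hd).measurable.div_const _).ennreal_ofReal

theorem integral_boundaryMeasure (hd : ∀ z : ℂ, 0 ≤ z.im → DifferentiableAt ℂ f z)
    (hC : ∀ z : ℂ, 0 ≤ z.im → ‖f z‖ ≤ C / (1 + ‖z‖)) (him : ∀ x : ℝ, 0 ≤ (f x).im)
    {z : ℂ} (hz : 0 < z.im) : ∫ x : ℝ, 1 / ((x : ℂ) - z) ∂(boundaryMeasure f) = f z := by
  rw [boundaryMeasure, integral_withDensity_eq_integral_toReal_smul (measurable_density hd)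
    (Eventually.of_forall fun _ => ENNReal.ofReal_lt_top)]
  have h1 : ∀ x : ℝ, (ENNReal.ofReal ((f x).im / Real.pi)).toReal • (1 / ((x : ℂ) - z)) =
      (Real.pi : ℂ)⁻¹ * (((f x).im : ℂ) / ((x : ℂ) - z)) := fun x => by
    rw [ENNReal.toReal_ofReal (div_nonneg (him x) Real.pi_pos.le), real_smul]
    push_cast
    ring
  simp_rw [h1]
  rw [integral_const_mul, (integral_im_div_sub_eq hd hC hz).2, ← mul_assoc,
    inv_mul_cancel₀ (by exact_mod_cast Real.pi_ne_zero), one_mul]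

/-- This is y times the imaginary part of the representation at z = iy. The kernel increases to 1
with y, so it controls both total mass and tails. -/
theorem lintegral_boundaryMeasure (hd : ∀ z : ℂ, 0 ≤ z.im → DifferentiableAt ℂ f z)
    (hC : ∀ z : ℂ, 0 ≤ z.im → ‖f z‖ ≤ C / (1 + ‖z‖)) (him : ∀ x : ℝ, 0 ≤ (f x).im)
    {y : ℝ} (hy : 0 < y) : ∫⁻ x : ℝ, ENNReal.ofReal ((1 + (x / y) ^ 2)⁻¹) ∂(boundaryMeasure f) =
      ENNReal.ofReal (y * (f (y * I)).im) := by
  have hk : Measurable fun x : ℝ => ENNReal.ofReal ((1 + (x / y) ^ 2)⁻¹) := by fun_prop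
  rw [boundaryMeasure, lintegral_withDensity_eq_lintegral_mul _ (measurable_density hd) hk]
  obtain ⟨hint, hval⟩ := integral_im_div_sub_eq hd hC (z := y * I) (by simpa using hy)
  have h1 : ∀ x : ℝ, (f x).im / Real.pi * (1 + (x / y) ^ 2)⁻¹ =
      y / Real.pi * (((f x).im : ℂ) / ((x : ℂ) - y * I)).im := fun x => by
    rw [div_im, normSq_apply]
    have h2 : x * x + y * y ≠ 0 := (add_pos_of_nonneg_of_pos (mul_self_nonneg x) (mul_pos hy hy)).ne'
    simp only [sub_re, ofReal_re, mul_re, I_re, mul_zero, ofReal_im, I_im, mul_one,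
      sub_im, mul_im, zero_sub, sub_zero, add_zero, zero_mul, zero_div, mul_neg, neg_mul, neg_neg]
    have h3 : 1 + (x / y) ^ 2 = (x * x + y * y) / y ^ 2 := by
      field_simp
      ring
    rw [h3, inv_div]
    ring
  have h4 : ∀ x : ℝ, ((fun x : ℝ => ENNReal.ofReal ((f x).im / Real.pi)) *
      fun x => ENNReal.ofReal ((1 + (x / y) ^ 2)⁻¹)) x =
      ENNReal.ofReal (y / Real.pi * (((f x).im : ℂ) / ((x : ℂ) - y * I)).im) := fun x => by
    rw [Pi.mul_apply, ← ENNReal.ofReal_mul (div_nonneg (him x) Real.pi_pos.le), h1]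
  simp_rw [h4]
  have him' : Integrable fun x : ℝ => (((f x).im : ℂ) / ((x : ℂ) - y * I)).im := hint.im
  rw [← ofReal_integral_eq_lintegral_ofReal (him'.const_mul _)
    (Eventually.of_forall fun x => ?_)]
  · congr 1
    rw [integral_const_mul]
    have h5 : ∫ x : ℝ, (((f x).im : ℂ) / ((x : ℂ) - y * I)).im = Real.pi * (f (y * I)).im := by
      have := integral_im hint
      rw [hval] at this
      refine Eq.trans this ?_
      simp
    rw [h5]
    field_simp
  · change 0 ≤ y / Real.pi * (((f x).im : ℂ) / ((x : ℂ) - y * I)).im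
    rw [← h1]
    exact mul_nonneg (div_nonneg (him x) Real.pi_pos.le) (by positivity)

theorem isProbabilityMeasure_boundaryMeasure
    (hd : ∀ z : ℂ, 0 ≤ z.im → DifferentiableAt ℂ f z)
    (hC : ∀ z : ℂ, 0 ≤ z.im → ‖f z‖ ≤ C / (1 + ‖z‖)) (him : ∀ x : ℝ, 0 ≤ (f x).im)
    (hlim : Tendsto (fun y : ℝ => y * (f (y * I)).im) atTop (𝓝 1)) :
    IsProbabilityMeasure (boundaryMeasure f) := by
  have hy : ∀ n : ℕ, (0 : ℝ) < n + 1 := fun n => by positivity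
  have h1 : Tendsto (fun n : ℕ => ∫⁻ x : ℝ, ENNReal.ofReal ((1 + (x / (n + 1 : ℝ)) ^ 2)⁻¹)
      ∂(boundaryMeasure f)) atTop (𝓝 (∫⁻ _, 1 ∂(boundaryMeasure f))) := by
    refine lintegral_tendsto_of_tendsto_of_monotone (fun n => by fun_prop) ?_ ?_
    · refine Eventually.of_forall fun x n k hnk => ENNReal.ofReal_le_ofReal ?_
      simp only [div_pow]
      have : (n : ℝ) ≤ k := by exact_mod_cast hnk
      gcongr
    · refine Eventually.of_forall fun x => ?_
      have h2 : Tendsto (fun n : ℕ => x / (n + 1 : ℝ)) atTop (𝓝 0) :=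
        tendsto_const_nhds.div_atTop (tendsto_atTop_add_const_right _ _ tendsto_natCast_atTop_atTop)
      have h3 := (((h2.pow 2).const_add 1).inv₀ (by norm_num))
      simpa using ENNReal.tendsto_ofReal h3
  have h2 : Tendsto (fun n : ℕ => ENNReal.ofReal (((n + 1 : ℝ)) * (f ((n + 1 : ℝ) * I)).im)) atTop
      (𝓝 (ENNReal.ofReal 1)) := by
    refine ENNReal.tendsto_ofReal (hlim.comp (g := fun y : ℝ => y * (f (y * I)).im) ?_)
    exact tendsto_atTop_add_const_right _ _ tendsto_natCast_atTop_atTop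
  have h3 := tendsto_nhds_unique (h1.congr fun n => lintegral_boundaryMeasure hd hC him (hy n)) h2
  exact ⟨by simpa using h3⟩

theorem boundaryMeasure_real_compl_closedBall_le
    (hd : ∀ z : ℂ, 0 ≤ z.im → DifferentiableAt ℂ f z)
    (hC : ∀ z : ℂ, 0 ≤ z.im → ‖f z‖ ≤ C / (1 + ‖z‖)) (him : ∀ x : ℝ, 0 ≤ (f x).im)
    [IsProbabilityMeasure (boundaryMeasure f)] {r : ℝ} (hr : 0 < r)
    (hfr : 0 ≤ (f (r * I)).im) :
    (boundaryMeasure f).real (Metric.closedBall 0 r)ᶜ ≤ 2 * (1 - r * (f (r * I)).im) := by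
  set μ := boundaryMeasure f
  have hpos : ∀ x : ℝ, 0 ≤ (1 + (x / r) ^ 2)⁻¹ := fun x => by positivity
  have hcont : Continuous fun x : ℝ => (1 + (x / r) ^ 2)⁻¹ :=
    Continuous.inv₀ (by fun_prop) fun x => by positivity
  have h1 : ∫ x : ℝ, (1 + (x / r) ^ 2)⁻¹ ∂μ = r * (f (r * I)).im := by
    rw [integral_eq_lintegral_of_nonneg_ae (Eventually.of_forall hpos)
      hcont.aestronglyMeasurable, lintegral_boundaryMeasure hd hC him hr,
      ENNReal.toReal_ofReal (mul_nonneg hr.le hfr)]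
  have hint : Integrable (fun x : ℝ => (1 + (x / r) ^ 2)⁻¹) μ := by
    refine Integrable.of_bound hcont.aestronglyMeasurable 1 (Eventually.of_forall fun x => ?_)
    rw [Real.norm_of_nonneg (hpos x)]
    exact inv_le_one_of_one_le₀ (by nlinarith [sq_nonneg (x / r)])
  have hmeas : MeasurableSet (Metric.closedBall (0 : ℝ) r)ᶜ :=
    Metric.isClosed_closedBall.measurableSet.compl
  -- Outside the ball the kernel is at most 1/2, so kernel plus half the indicator stays below 1.
  have hint2 : Integrable ((Metric.closedBall (0 : ℝ) r)ᶜ.indicator fun _ => (1 / 2 : ℝ)) μ :=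
    (integrable_const _).indicator hmeas
  have h2 : ∫ x : ℝ, ((1 + (x / r) ^ 2)⁻¹ +
      (Metric.closedBall (0 : ℝ) r)ᶜ.indicator (fun _ => (1 / 2 : ℝ)) x) ∂μ ≤ ∫ _, 1 ∂μ := by
    refine integral_mono (hint.add hint2) (integrable_const _) fun x => ?_
    by_cases hx : x ∈ (Metric.closedBall (0 : ℝ) r)ᶜ
    · simp only [indicator_of_mem hx]
      have h3 : 1 ≤ (x / r) ^ 2 := by
        rw [mem_compl_iff, Metric.mem_closedBall, dist_zero_right, Real.norm_eq_abs, not_le] at hx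
        rw [one_le_sq_iff_one_le_abs, abs_div, abs_of_pos hr, one_le_div hr]
        exact hx.le
      have h4 : (1 + (x / r) ^ 2)⁻¹ ≤ 2⁻¹ := by gcongr; linarith
      linarith
    · simp only [indicator_of_notMem hx, add_zero]
      exact inv_le_one_of_one_le₀ (by nlinarith [sq_nonneg (x / r)])
  rw [integral_add hint hint2, h1, integral_indicator_const _ hmeas, integral_const] at h2
  simp only [smul_eq_mul, probReal_univ, mul_one] at h2
  linarith

end Complex

/-! ### Existence of the representing measure by compactness. -/

namespace Complex

variable {m : ℂ → ℂ}

theorem exists_norm_le_div_one_add_norm (hm : ContinuousOn m {z | 0 < z.im})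
    (hlim : Tendsto (fun z => z * m z) (cobounded ℂ ⊓ 𝓟 {z | 0 < z.im}) (𝓝 (-1)))
    {η : ℝ} (hη : 0 < η) : ∃ C, ∀ z : ℂ, η ≤ z.im → ‖m z‖ ≤ C / (1 + ‖z‖) := by
  have h1 : ∀ᶠ z in cobounded ℂ ⊓ 𝓟 {z : ℂ | 0 < z.im}, ‖z * m z‖ < 2 :=
    hlim.norm.eventually (gt_mem_nhds (by norm_num))
  rw [eventually_inf_principal] at h1
  obtain ⟨R, hR⟩ := (Metric.isBounded_iff_subset_closedBall (0 : ℂ)).1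
    (isBounded_def.2 (by rwa [compl_compl] :
      {z : ℂ | z ∈ {z : ℂ | 0 < z.im} → ‖z * m z‖ < 2}ᶜᶜ ∈ cobounded ℂ))
  have hK : IsCompact (Metric.closedBall (0 : ℂ) (max R 1) ∩ {z : ℂ | η ≤ z.im}) :=
    (isCompact_closedBall _ _).inter_right (isClosed_le continuous_const continuous_im)
  obtain ⟨M, hM⟩ := hK.exists_bound_of_continuousOn
    (hm.mono fun z hz => hη.trans_le hz.2)
  -- The 4 comes from ‖z m(z)‖ < 2 and 1 + ‖z‖ ≤ 2‖z‖ far out; the other entry covers the compact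
  -- part.
  refine ⟨max 4 (|M| * (1 + max R 1)), fun z hz => ?_⟩
  rw [le_div_iff₀ (by positivity)]
  by_cases hzR : ‖z‖ ≤ max R 1
  · refine le_trans ?_ (le_max_right _ _)
    have := (hM z ⟨by simpa using hzR, hz⟩).trans (le_abs_self M)
    gcongr
  · refine le_trans ?_ (le_max_left _ _)
    rw [not_le, max_lt_iff] at hzR
    have h2 : ‖z * m z‖ < 2 := by
      by_contra h3
      have := hR (show z ∈ {z : ℂ | z ∈ {z : ℂ | 0 < z.im} → ‖z * m z‖ < 2}ᶜ from
        fun h => h3 (h (hη.trans_le hz)))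
      rw [Metric.mem_closedBall, dist_zero_right] at this
      linarith
    rw [norm_mul] at h2
    nlinarith [norm_nonneg (m z), hzR.2]

theorem tendsto_mul_im_of_tendsto
    (hlim : Tendsto (fun z => z * m z) (cobounded ℂ ⊓ 𝓟 {z | 0 < z.im}) (𝓝 (-1))) :
    Tendsto (fun y : ℝ => y * (m (y * I)).im) atTop (𝓝 1) := by
  have h := ((continuous_re.tendsto _).comp (hlim.comp tendsto_ofReal_mul_I_cobounded)).neg
  simpa [Function.comp_def] using h

/-- A holomorphic function on the upper half-plane with nonnegative imaginary part that behaves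
like `-1/z` at infinity is the Stieltjes transform of a probability measure. -/
theorem exists_isProbabilityMeasure_stieltjes (hm : DifferentiableOn ℂ m {z | 0 < z.im})
    (him : ∀ z : ℂ, 0 < z.im → 0 ≤ (m z).im)
    (hlim : Tendsto (fun z => z * m z) (cobounded ℂ ⊓ 𝓟 {z | 0 < z.im}) (𝓝 (-1))) :
    ∃ ρ : Measure ℝ, IsProbabilityMeasure ρ ∧
      ∀ z : ℂ, 0 < z.im → m z = ∫ x : ℝ, 1 / ((x : ℂ) - z) ∂ρ := by
  have hH : IsOpen {z : ℂ | 0 < z.im} := isOpen_lt continuous_const continuous_im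
  have hlim1 := tendsto_mul_im_of_tendsto hlim
  set η : ℕ → ℝ := fun n => 1 / ((n : ℝ) + 1) with hη
  have hη0 : ∀ n, 0 < η n := fun n => by positivity
  have hη1 : ∀ n, η n ≤ 1 := fun n => by
    rw [hη, div_le_one (by positivity)]
    linarith [(n.cast_nonneg : (0 : ℝ) ≤ n)]
  have hηlim : Tendsto η atTop (𝓝 0) := tendsto_one_div_add_atTop_nhds_zero_nat
  set f : ℕ → ℂ → ℂ := fun n z => m (z + η n * I) with hf
  have himf : ∀ (n : ℕ) (z : ℂ), 0 ≤ z.im → η n ≤ (z + η n * I).im := fun n z hz => by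
    simpa using hz
  have hfd : ∀ (n : ℕ) (z : ℂ), 0 ≤ z.im → DifferentiableAt ℂ (f n) z := fun n z hz => by
    have h1 := hm.differentiableAt (hH.mem_nhds ((hη0 n).trans_le (himf n z hz)))
    exact h1.comp z (by fun_prop)
  have hfC : ∀ n : ℕ, ∃ C, ∀ z : ℂ, 0 ≤ z.im → ‖f n z‖ ≤ C / (1 + ‖z‖) := fun n => by
    obtain ⟨C, hC⟩ := exists_norm_le_div_one_add_norm hm.continuousOn hlim (hη0 n)
    have hC0 : 0 ≤ C := by
      have := (norm_nonneg _).trans (hC (η n * I) (by simp))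
      by_contra! h
      exact absurd this (not_le.2 (div_neg_of_neg_of_pos h (by positivity)))
    refine ⟨C, fun z hz => (hC _ (himf n z hz)).trans ?_⟩
    gcongr
    rw [← sq_le_sq₀ (norm_nonneg _) (norm_nonneg _), ← normSq_eq_norm_sq, ← normSq_eq_norm_sq,
      normSq_apply, normSq_apply]
    simp only [add_re, mul_re, ofReal_re, I_re, mul_zero, ofReal_im, I_im, mul_one, sub_self,
      add_zero, add_im, mul_im]
    nlinarith [hη0 n]
  have hf0 : ∀ (n : ℕ) (z : ℂ), 0 ≤ z.im → 0 ≤ (f n z).im := fun n z hz =>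
    him _ ((hη0 n).trans_le (himf n z hz))
  have hfy : ∀ (n : ℕ) (y : ℝ), f n (y * I) = m ((y + η n : ℝ) * I) := fun n y => by
    rw [hf]
    push_cast
    ring_nf
  have hlimf : ∀ n, Tendsto (fun y : ℝ => y * (f n (y * I)).im) atTop (𝓝 1) := fun n => by
    have h1 : Tendsto (fun y : ℝ => y + η n) atTop atTop :=
      tendsto_atTop_add_const_right _ _ tendsto_id
    have h2 := hlim1.comp h1
    have h3 : Tendsto (fun y : ℝ => 1 - η n / (y + η n)) atTop (𝓝 (1 - 0)) :=
      (tendsto_const_nhds.div_atTop h1).const_sub 1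
    have h4 := h3.mul h2
    rw [sub_zero, one_mul] at h4
    refine h4.congr' ?_
    filter_upwards [eventually_gt_atTop 0] with y hy
    have h5 : y + η n ≠ 0 := (add_pos hy (hη0 n)).ne'
    rw [hfy]
    simp only [Function.comp_apply]
    field_simp
    ring
  have hprob : ∀ n, IsProbabilityMeasure (boundaryMeasure (f n)) := fun n => by
    obtain ⟨C, hC⟩ := hfC n
    exact isProbabilityMeasure_boundaryMeasure (hfd n) hC (fun x => hf0 n x (by simp)) (hlimf n)
  set ρ : ℕ → ProbabilityMeasure ℝ := fun n => ⟨boundaryMeasure (f n), hprob n⟩ with hρ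
  have htight : IsTightMeasureSet {((μ : ProbabilityMeasure ℝ) : Measure ℝ) | μ ∈ range ρ} := by
    refine isTightMeasureSet_iff_exists_isCompact_measure_compl_le.2 fun ε hε => ?_
    obtain ⟨ε', hε'0, hε'⟩ := ENNReal.lt_iff_exists_nnreal_btwn.1 hε
    have hε'0 : 0 < (ε' : ℝ) := by exact_mod_cast hε'0
    -- One δ is lost in the limit y Im m(iy) → 1 and one in the shift by η; the tail bound doubles
    -- this to 4δ.
    set δ : ℝ := min (ε' / 4) (1 / 2) with hδ
    have hδ0 : 0 < δ := lt_min (by linarith) (by norm_num)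
    have h1 : ∀ᶠ r : ℝ in atTop, ∀ y ≥ r, 1 - δ < y * (m (y * I)).im :=
      eventually_forall_ge_atTop.2
        (hlim1.eventually (lt_mem_nhds (show 1 - δ < 1 by linarith)))
    obtain ⟨r, hr1, hr2, hr0⟩ := (h1.and ((eventually_ge_atTop (1 / δ)).and
      (eventually_gt_atTop 0))).exists
    refine ⟨Metric.closedBall 0 r, isCompact_closedBall _ _, ?_⟩
    rintro _ ⟨_, ⟨n, rfl⟩, rfl⟩
    obtain ⟨C, hC⟩ := hfC n
    have := hprob n
    have h2 := boundaryMeasure_real_compl_closedBall_le (hfd n) hC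
      (fun x => hf0 n x (by simp)) hr0 (hf0 n _ (by simpa using hr0.le))
    have h3 : 1 - 2 * δ ≤ r * (f n (r * I)).im := by
      have h4 := hr1 (r + η n) (by linarith [hη0 n])
      rw [hfy]
      set v := (m ((r + η n : ℝ) * I)).im with hv
      have h5 : 0 ≤ v := him _ (by simpa using add_pos hr0 (hη0 n))
      have h6 : η n ≤ δ * r := by
        rw [div_le_iff₀ hδ0] at hr2
        linarith [hη1 n]
      have h7 : (1 - δ) * ((r + η n) * v) ≤ r * v := by
        rw [← mul_assoc]
        gcongr
        nlinarith [mul_pos hδ0 (hη0 n)]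
      have h8 : (1 - δ) * (1 - δ) ≤ (1 - δ) * ((r + η n) * v) := by
        have : δ ≤ 1 / 2 := min_le_right _ _
        exact mul_le_mul_of_nonneg_left h4.le (by linarith)
      nlinarith [sq_nonneg δ]
    have h4 : (boundaryMeasure (f n)).real (Metric.closedBall 0 r)ᶜ ≤ ε' := by
      have : δ ≤ ε' / 4 := min_le_left _ _
      linarith
    refine le_trans ?_ hε'.le
    rw [← ENNReal.ofReal_coe_nnreal]
    exact (ofReal_measureReal (measure_ne_top _ _)).symm.le.trans (ENNReal.ofReal_le_ofReal h4)
  have hcomp := isCompact_closure_of_isTightMeasureSet htight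
  -- A nonprincipal ultrafilter replaces the choice of a convergent subsequence.
  obtain ⟨μ, -, hμ⟩ := hcomp.ultrafilter_le_nhds' ((hyperfilter ℕ).map ρ)
    (Ultrafilter.mem_map.2 (univ_mem' fun n => subset_closure (mem_range_self n)))
  have hμ' : Tendsto ρ (hyperfilter ℕ) (𝓝 μ) := hμ
  refine ⟨μ, inferInstance, fun z hz => ?_⟩
  have hcont : Continuous fun x : ℝ => 1 / ((x : ℂ) - z) :=
    Continuous.div (by fun_prop) (by fun_prop) (ofReal_sub_ne_zero hz.ne')
  have hbd : ∀ x : ℝ, ‖1 / ((x : ℂ) - z)‖ ≤ 1 / z.im := fun x => by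
    rw [norm_div, norm_one]
    gcongr
    exact im_le_norm_ofReal_sub hz x
  have h1 := (ProbabilityMeasure.tendsto_iff_forall_integral_rclike_tendsto ℂ).1 hμ'
    (BoundedContinuousFunction.ofNormedAddCommGroup _ hcont _ hbd)
  have h2 : ∀ n, ∫ x : ℝ, 1 / ((x : ℂ) - z) ∂(ρ n : Measure ℝ) = f n z := fun n => by
    obtain ⟨C, hC⟩ := hfC n
    exact integral_boundaryMeasure (hfd n) hC (fun x => hf0 n x (by simp)) hz
  have h3 : Tendsto (fun n => f n z) atTop (𝓝 (m z)) := by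
    have h4 : Tendsto (fun n => z + η n * I) atTop (𝓝 (z + (0 : ℝ) * I)) :=
      (((continuous_ofReal.tendsto 0).comp hηlim).mul_const I).const_add z
    rw [ofReal_zero, zero_mul, add_zero] at h4
    exact ((hm.continuousOn.continuousAt (hH.mem_nhds hz)).tendsto).comp h4
  refine tendsto_nhds_unique (h3.mono_left Nat.hyperfilter_le_atTop) (h1.congr fun n => ?_)
  exact h2 n

end Complex

/-! ### Transfer to the matrix equation. -/

namespace IsScalarSolution

open UpperHalfPlane

variable {l : ℕ} {A : Matrix (Fin l) (Fin l) ℂ} {b : Fin l → ℝ} {c : ℝ} {m : ℍ → ℍ}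

theorem coe_ofComplex {z : ℂ} (hz : 0 < z.im) : (ofComplex z : ℂ) = z := by
  rw [ofComplex_apply_of_im_pos hz]

theorem tendsto_ofComplex (h : IsScalarSolution A b c m) :
    Tendsto (fun z : ℂ => z * (m (ofComplex z) : ℂ)) (cobounded ℂ ⊓ 𝓟 {z | 0 < z.im})
      (𝓝 (-1)) := by
  have hr : range (fun z : ℍ => (z : ℂ)) = {z : ℂ | 0 < z.im} := by
    ext z
    exact ⟨by rintro ⟨w, rfl⟩; exact w.im_pos, fun hz => ⟨⟨z, hz⟩, rfl⟩⟩
  rw [← hr, ← map_comap, tendsto_map'_iff]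
  refine h.tendsto.congr fun z => ?_
  simp only [Function.comp_apply, ofComplex_apply]

theorem tendsto_zero (h : IsScalarSolution A b c m) :
    Tendsto (fun z : ℂ => (m (ofComplex z) : ℂ)) (cobounded ℂ ⊓ 𝓟 {z | 0 < z.im}) (𝓝 0) := by
  have h1 := ((tendsto_inv₀_cobounded (α := ℂ)).mono_left
    (inf_le_left (b := 𝓟 {z : ℂ | 0 < z.im}))).mul h.tendsto_ofComplex
  rw [zero_mul] at h1
  refine h1.congr' ?_
  filter_upwards [mem_inf_of_right (mem_principal_self _)] with z hz
  have hz0 : z ≠ 0 := by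
    rintro rfl
    simp at hz
  rw [inv_mul_cancel_left₀ hz0]

theorem mem_dom (hA : A.IsHermitian) (hA0 : A ≠ 0) (h : IsScalarSolution A b c m) (z : ℍ) :
    (m z : ℂ) ∈ (spectralDataOfMatrix hA hA0 b c).dom ∧
      (spectralDataOfMatrix hA hA0 b c).invFun (m z) = z := by
  have h1 : ∀ z : ℍ, (spectralDataOfMatrix hA hA0 b c).invFun (m z) = z := fun z => by
    rw [SpectralData.invFun, ← selfEnergy_eq_energy hA hA0 b c (m z).im_pos, h.equation z]
    ring
  have h2 := SpectralData.mem_dom_of_invFun_eq _ h.analytic.continuousOn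
    (fun w hw => ⟨(m (ofComplex w)).im_pos, (h1 _).trans (coe_ofComplex hw)⟩)
    h.tendsto_zero z.im_pos
  simp only [ofComplex_apply] at h2
  exact ⟨h2, h1 z⟩

theorem unique (hA : A.IsHermitian) (hA0 : A ≠ 0) {m₁ m₂ : ℍ → ℍ}
    (h₁ : IsScalarSolution A b c m₁) (h₂ : IsScalarSolution A b c m₂) : m₁ = m₂ := by
  funext z
  obtain ⟨h3, h4⟩ := h₁.mem_dom hA hA0 z
  obtain ⟨h5, h6⟩ := h₂.mem_dom hA hA0 z
  exact UpperHalfPlane.ext ((spectralDataOfMatrix hA hA0 b c).injOn_invFun h3 h5 (h4.trans h6.symm))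

theorem exists_solution (hA : A.IsHermitian) (hA0 : A ≠ 0) (b : Fin l → ℝ) (c : ℝ) :
    ∃ m : ℍ → ℍ, IsScalarSolution A b c m := by
  obtain ⟨f, hf, hdom, hlim⟩ := (spectralDataOfMatrix hA hA0 b c).exists_inverse
  have hpos : ∀ z : ℍ, 0 < (f z).im := fun z => (hdom z z.im_pos).1.1.1
  refine ⟨fun z => ⟨f z, hpos z⟩, ?_, ?_, fun z => ?_⟩
  · have hH : IsOpen {z : ℂ | 0 < z.im} := isOpen_lt continuous_const Complex.continuous_im
    refine hf.congr hH fun w hw => ?_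
    change f w = f (ofComplex w)
    rw [coe_ofComplex hw]
  · refine hlim.comp (tendsto_inf.2 ⟨tendsto_comap, tendsto_principal.2 ?_⟩)
    exact Eventually.of_forall fun z => z.im_pos
  · change -(f z)⁻¹ = z + selfEnergy A b c (f z)
    rw [selfEnergy_eq_energy hA hA0 b c (hpos z)]
    have := (hdom z z.im_pos).2
    rw [SpectralData.invFun] at this
    exact sub_eq_iff_eq_add.1 this

end IsScalarSolution

end

theorem proposition2p2 {l : ℕ} (A : Matrix (Fin l) (Fin l) ℂ) (hA : A.IsHermitian) (hA0 : A ≠ 0)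
    (b : Fin l → ℝ) (c : ℝ) :
    (∃! m : ℍ → ℍ, IsScalarSolution A b c m) ∧
      ∀ m : ℍ → ℍ, IsScalarSolution A b c m →
        ∃! ρ : MeasureTheory.Measure ℝ,
          MeasureTheory.IsProbabilityMeasure ρ ∧ IsStieltjesTransform ρ m := by
  refine ⟨?_, fun m hm => ?_⟩
  · obtain ⟨m, hm⟩ := IsScalarSolution.exists_solution hA hA0 b c
    exact ⟨m, hm, fun m' hm' => hm'.unique hA hA0 hm⟩
  · obtain ⟨ρ, hρ, hS⟩ := Complex.exists_isProbabilityMeasure_stieltjes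
      hm.analytic.differentiableOn (fun z _ => (m (UpperHalfPlane.ofComplex z)).im_pos.le)
      hm.tendsto_ofComplex
    have hS' : IsStieltjesTransform ρ m := fun z => by
      have := hS z z.im_pos
      simpa only [UpperHalfPlane.ofComplex_apply] using this
    refine ⟨ρ, ⟨hρ, hS'⟩, fun ρ' hρ' => ?_⟩
    have := hρ'.1
    exact Complex.measure_eq_of_stieltjes_eq ρ' ρ fun z hz =>
      (hρ'.2 ⟨z, hz⟩).symm.trans (hS' ⟨z, hz⟩)
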